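/- Let $|E|$ denote the Lebesgue measure of $E\subset\mathbb R$, let $\mathbf 1_E$ be the indicator function of $E$, let $\widehat f(\xi)=\int_{\mathbb R}e^{-2\pi i x\xi}f(x)\,dx$, and let $\mathbb B=[-1,1]$. For $q\in(2,\infty)$ put $q'=q/(q-1)$, and for Lebesgue measurable $E\subset\mathbb R$ with $0<|E|<\infty$ define $$\Phi_q(E)=|E|^{-1/q'}\,\|\widehat{\mathbf 1_E}\|_{L^q(\mathbb R)},\qquad \operatorname{dist}(E,\mathfrak E)=\inf_{I}\frac{|I\,\Delta\,E|}{|E|},$$ where the infimum runs over all compact intervals $I$ with $|I|=|E|$. Let $K_q:\mathbb R\to\mathbb R$ be the continuous function with $\widehat{K_q}=\widehat{\mathbf 1_{\mathbb B}}\,|\widehat{\mathbf 1_{\mathbb B}}|^{q-2}$. Proposition 2.8. Let $q>3$ and suppose that $$\inf_{|x|\le 1-\delta}K_q(x)>\sup_{|x|\ge 1+\delta}K_q(x)\qquad\text{for all }\delta\in(0,1].$$ Then there exist $c_q>0$ and $\eta>0$ such that $$\Phi_q(E)\le\Phi_q(\mathbb B)-c_q\operatorname{dist}(E,\mathfrak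 E)^2$$ for every Lebesgue measurable set $E\subset\mathbb R$ with $0<|E|<\infty$ and $\operatorname{dist}(E,\mathfrak E)<\eta$. -/

import Mathlib

open MeasureTheory
open scoped FourierTransform symmDiff

namespace FourierExtremizer

/-- The closed unit ball `{x : |x| ≤ 1}` of `ℝ`, that is, the interval `[-1, 1]`. -/
def unitBall : Set ℝ := {x : ℝ | |x| ≤ 1}

/-- The Fourier transform `ξ ↦ ∫ exp (-2πi x ξ) 1_E(x) dx` of the indicator function of `E`. -/
noncomputable def indicatorHat (E : Set ℝ) : ℝ → ℂ :=
  𝓕 (E.indicator (fun _ : ℝ => (1 : ℂ)))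

/-- `Φ_q(E) = |E| ^ (-1/q') * ‖(1_E)^‖_q`, with `q' = q / (q - 1)`. -/
noncomputable def Phi (q : ℝ) (E : Set ℝ) : ℝ :=
  (volume E).toReal ^ (-(1 / (q / (q - 1)))) *
    (eLpNorm (indicatorHat E) (ENNReal.ofReal q) volume).toReal

/-- Ellipsoids of `ℝ`: the images of the unit ball under affine automorphisms. -/
def IsEllipsoid (S : Set ℝ) : Prop :=
  ∃ T : ℝ ≃ᵃ[ℝ] ℝ, S = T '' unitBall

/-- The normalized distance from `E` to the set of ellipsoids (in `ℝ`: compact intervals): the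
infimum of `|S ∆ E| / |E|` over all ellipsoids `S` with `|S| = |E|`. -/
noncomputable def distEllipsoids (E : Set ℝ) : ℝ :=
  sInf {r : ℝ | ∃ S : Set ℝ, IsEllipsoid S ∧ volume S = volume E ∧
    r = (volume (S ∆ E)).toReal / (volume E).toReal}

/-- The function `K_q` whose Fourier transform is `(1_B)^ * |(1_B)^| ^ (q - 2)`, `B` the unit ball.
For `q > 2` this product is integrable, real-valued and even, so that `K_q` is its inverse Fourier
transform, given by an absolutely convergent integral; the latter is real-valued, hence equal to
its real part. -/
noncomputable def K (q : ℝ) (x : ℝ) : ℝ :=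
  (𝓕⁻ (fun ξ : ℝ =>
    indicatorHat unitBall ξ * ((‖indicatorHat unitBall ξ‖ ^ (q - 2) : ℝ) : ℂ)) x).re

/-- In dimension one the ellipsoids are exactly the nondegenerate compact intervals. -/
theorem isEllipsoid_iff (S : Set ℝ) :
    IsEllipsoid S ↔ ∃ a b : ℝ, a < b ∧ S = Set.Icc a b := by
  have key : ∀ m r : ℝ, r ≠ 0 →
      (fun x : ℝ => r * x + m) '' unitBall = Set.Icc (m - |r|) (m + |r|) := by
    intro m r hr
    ext y
    simp only [unitBall, Set.mem_image, Set.mem_ofPred_eq, Set.mem_Icc]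
    constructor
    · rintro ⟨x, hx, rfl⟩
      have h : |r * x| ≤ |r| := by
        rw [abs_mul]; exact mul_le_of_le_one_right (abs_nonneg r) hx
      have h2 := abs_le.1 h
      constructor <;> linarith [h2.1, h2.2]
    · rintro ⟨h1, h2⟩
      refine ⟨(y - m) / r, ?_, by field_simp; ring⟩
      rw [abs_div, div_le_one (abs_pos.2 hr), abs_le]
      constructor <;> linarith
  constructor
  · rintro ⟨T, rfl⟩
    have hT : ∀ x : ℝ, T x = T.linear 1 * x + T 0 := by
      intro x
      have h1 := T.map_vadd 0 x
      have h2 : T.linear x = x * T.linear 1 := by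
        have := T.linear.map_smul x 1
        simpa using this
      simp only [vadd_eq_add, add_zero] at h1
      rw [h1, h2]; ring
    have hr : T.linear 1 ≠ 0 := by simp
    refine ⟨T 0 - |T.linear 1|, T 0 + |T.linear 1|, ?_, ?_⟩
    · have := abs_pos.2 hr
      linarith
    · rw [← key _ _ hr]
      exact Set.image_congr (fun x _ => hT x)
  · rintro ⟨a, b, hab, rfl⟩
    have hr : (b - a) / 2 ≠ 0 := by
      have : 0 < b - a := by linarith
      positivity
    refine ⟨(LinearEquiv.smulOfNeZero ℝ ℝ ((b - a) / 2) hr).toAffineEquiv.trans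
      (AffineEquiv.constVAdd ℝ ℝ ((a + b) / 2)), ?_⟩
    have h := key ((a + b) / 2) ((b - a) / 2) hr
    have habs : |(b - a) / 2| = (b - a) / 2 := abs_of_pos (by linarith)
    rw [habs] at h
    have e1 : (a + b) / 2 - (b - a) / 2 = a := by ring
    have e2 : (a + b) / 2 + (b - a) / 2 = b := by ring
    rw [e1, e2] at h
    rw [← h]
    apply Set.image_congr
    intro x _
    simp [add_comm]

end FourierExtremizer

namespace FourierExtremizer

open Real Set Filter Topology

/-! An affine change of variables gives `E` measure 2 and median 0. Let `f` be the difference of the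
indicators of `E` and the unit ball: it is nonpositive on the ball, nonnegative off it, and has
integral zero on each half-line. Put δ = ∫ |f| and m = ∫ |f| · `edgeDist`. Since |f| ≤ 1, little
mass fits near ±1, so δ² ≤ 16 m (`sq_integral_abs_le`).

Expand ∫ |B̂ + f̂|^q to second order, where B̂ is the transform of the ball (`norm_add_rpow_le`).
The linear term is q ∫ K f. As ∫ f = 0, `K` may be replaced by `K` minus its value at 1, whose sign
is opposite to that of f and whose size is at least a constant times `edgeDist`; so the linear term
is at most -qκm. The remainder is O(δ^θ m) for some θ > 0. Here the median matters: it yields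
|f̂(ξ)| ≤ 2π(1 + |ξ|) m (`norm_fourier_le_edgeDist`) besides |f̂| ≤ δ. Small δ thus gives a loss of
order m, hence of order δ² (`exists_integral_norm_add_fourier_rpow_le`).

The linear gap of `K` at ±1 is proved directly. Up to a positive factor `K` is the cosine transform
of sinc |sinc|^s with s = q - 2 > 1. It is strictly decreasing on [0, 2] with nonzero slope at 1
(`sincPowSin_pos`), and on [2, ∞) it stays below its value at 1 by a fixed amount
(`exists_sincPowCos_le_sub`). -/

/-! ### Signed powers of sinc and their cosine transform. -/

lemma abs_sinc_le (t : ℝ) : |sinc t| ≤ 2 / (1 + |t|) := by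
  rw [le_div_iff₀ (by positivity)]
  have h1 := abs_sinc_le_one t
  have h2 : |sinc t| * |t| ≤ 1 := by
    rcases eq_or_ne t 0 with rfl | ht
    · simp
    · rw [← abs_mul, sinc_of_ne_zero ht, div_mul_cancel₀ _ ht]
      exact abs_sin_le_one t
  linarith

lemma mul_sinc (t : ℝ) : t * sinc t = sin t := by
  rcases eq_or_ne t 0 with rfl | ht
  · simp
  · rw [sinc_of_ne_zero ht, mul_div_cancel₀ _ ht]

lemma integrable_one_add_abs_rpow_mul_abs_sinc_rpow {θ r : ℝ} (hr : 0 ≤ r) (h : 1 < r - θ) :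
    Integrable (fun t : ℝ => (1 + |t|) ^ θ * |sinc t| ^ r) := by
  have h0 : Integrable (fun t : ℝ => (2 : ℝ) ^ r * (1 + ‖t‖) ^ (-(r - θ))) :=
    (integrable_one_add_norm (by simpa using h)).const_mul _
  refine h0.mono' (by
    have := continuous_sinc.measurable
    fun_prop) (ae_of_all _ fun t => ?_)
  have hp : 0 < 1 + |t| := by positivity
  rw [norm_of_nonneg (by positivity), norm_eq_abs]
  calc (1 + |t|) ^ θ * |sinc t| ^ r ≤ (1 + |t|) ^ θ * (2 / (1 + |t|)) ^ r := by
        gcongr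
        exact abs_sinc_le t
    _ = 2 ^ r * (1 + |t|) ^ (-(r - θ)) := by
        rw [div_rpow zero_le_two hp.le, neg_sub, rpow_sub hp]
        ring

lemma integrable_abs_sinc_rpow {r : ℝ} (hr : 1 < r) :
    Integrable (fun t : ℝ => |sinc t| ^ r) := by
  simpa using integrable_one_add_abs_rpow_mul_abs_sinc_rpow (θ := 0) (by linarith) (by simpa using hr)

/-- The signed power `sinc * |sinc| ^ s`. -/
noncomputable def sincPow (s t : ℝ) : ℝ := sinc t * |sinc t| ^ s

lemma continuous_sincPow {s : ℝ} (hs : 0 ≤ s) : Continuous (sincPow s) := by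
  unfold sincPow
  have := continuous_sinc
  exact this.mul (this.abs.rpow_const fun _ => Or.inr hs)

lemma sincPow_neg (s t : ℝ) : sincPow s (-t) = sincPow s t := by simp [sincPow]

lemma abs_sincPow {s : ℝ} (hs : 0 < s) (t : ℝ) : |sincPow s t| = |sinc t| ^ (s + 1) := by
  rw [sincPow, abs_mul, abs_of_nonneg (a := |sinc t| ^ s) (by positivity),
    rpow_add_one' (abs_nonneg _) (by linarith), mul_comm]

lemma integrable_sincPow {s : ℝ} (hs : 0 < s) : Integrable (sincPow s) := by
  refine (integrable_abs_sinc_rpow (r := s + 1) (by linarith)).mono'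
    (continuous_sincPow hs.le).aestronglyMeasurable (ae_of_all _ fun t => ?_)
  rw [norm_eq_abs, abs_sincPow hs]

/-- The cosine transform of `sinc * |sinc| ^ s`. -/
noncomputable def sincPowCos (s x : ℝ) : ℝ := ∫ t, sincPow s t * cos (x * t)

lemma integrable_sincPow_mul_cos {s : ℝ} (hs : 0 < s) (x : ℝ) :
    Integrable (fun t => sincPow s t * cos (x * t)) := by
  refine (integrable_sincPow hs).mul_bdd (c := 1) (by fun_prop) (ae_of_all _ fun t => ?_)
  exact abs_cos_le_one _

lemma sincPowCos_neg (s x : ℝ) : sincPowCos s (-x) = sincPowCos s x := by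
  simp [sincPowCos]

lemma sincPowCos_abs (s x : ℝ) : sincPowCos s |x| = sincPowCos s x := by
  rcases abs_choice x with h | h <;> rw [h]
  exact sincPowCos_neg s x

/-- Half of minus the derivative of `sincPowCos s`. -/
noncomputable def sincPowSin (s x : ℝ) : ℝ :=
  ∫ t in Ioi (0 : ℝ), sin t * |sinc t| ^ s * sin (x * t)

lemma integrable_sin_mul_abs_sinc_rpow {s : ℝ} (hs : 1 < s) :
    Integrable (fun t => sin t * |sinc t| ^ s) := by
  have := (integrable_abs_sinc_rpow hs).bdd_mul (c := 1) (f := fun t => sin t)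
    (by fun_prop) (ae_of_all _ fun t => abs_sin_le_one t)
  exact this

lemma integrable_sin_mul_abs_sinc_rpow_mul_sin {s : ℝ} (hs : 1 < s) (x : ℝ) :
    Integrable (fun t => sin t * |sinc t| ^ s * sin (x * t)) := by
  refine (integrable_sin_mul_abs_sinc_rpow hs).mul_bdd (c := 1) (by fun_prop)
    (ae_of_all _ fun t => abs_sin_le_one _)

/-- Differentiation under the integral brings down a factor t, which turns one sinc into sin. The
dominating function is then |sinc|^s, integrable because s > 1. Evenness of the integrand gives the
factor 2. -/
lemma hasDerivAt_sincPowCos {s : ℝ} (hs : 1 < s) (x : ℝ) :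
    HasDerivAt (sincPowCos s) (-2 * sincPowSin s x) x := by
  have hb : ∀ y t : ℝ, ‖-(sin t * |sinc t| ^ s * sin (y * t))‖ ≤ |sinc t| ^ s := by
    intro y t
    rw [norm_neg, norm_mul, norm_mul, norm_of_nonneg (r := |sinc t| ^ s) (by positivity)]
    have h1 := abs_sin_le_one t
    have h2 := abs_sin_le_one (y * t)
    have h3 : 0 ≤ |sinc t| ^ s := by positivity
    simp only [norm_eq_abs]
    calc |sin t| * |sinc t| ^ s * |sin (y * t)| ≤ 1 * |sinc t| ^ s * 1 := by gcongr
      _ = _ := by ring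
  have hd : ∀ y t : ℝ, HasDerivAt (fun x => sincPow s t * cos (x * t))
      (-(sin t * |sinc t| ^ s * sin (y * t))) y := by
    intro y t
    have h1 : HasDerivAt (fun y : ℝ => y * t) t y := by simpa using (hasDerivAt_id y).mul_const t
    have := (h1.cos).const_mul (sincPow s t)
    refine this.congr_deriv ?_
    rw [sincPow, ← mul_sinc t]
    ring
  have key := (hasDerivAt_integral_of_dominated_loc_of_deriv_le (μ := volume) (x₀ := x)
    (F := fun x t => sincPow s t * cos (x * t)) (s := univ)
    (F' := fun x t => -(sin t * |sinc t| ^ s * sin (x * t)))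
    (bound := fun t => |sinc t| ^ s) univ_mem
    (Eventually.of_forall fun y => (integrable_sincPow_mul_cos (by linarith) y).1)
    (integrable_sincPow_mul_cos (by linarith) x)
    (integrable_sin_mul_abs_sinc_rpow_mul_sin hs x).neg.1
    (ae_of_all _ fun t y _ => hb y t) (integrable_abs_sinc_rpow hs)
    (ae_of_all _ fun t y _ => hd y t)).2
  have e : (∫ t, -(sin t * |sinc t| ^ s * sin (x * t))) = -2 * sincPowSin s x := by
    rw [integral_neg, sincPowSin]
    have h := integral_comp_abs (f := fun t => sin t * |sinc t| ^ s * sin (x * t))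
    have h2 : (fun t : ℝ => sin (abs t) * |sinc (abs t)| ^ s * sin (x * abs t)) =
        fun t => sin t * |sinc t| ^ s * sin (x * t) := by
      ext t
      rcases abs_choice t with h | h <;> rw [h]
      simp
    rw [h2] at h
    rw [h]
    ring
  rw [← e]
  exact key

/-! ### Monotonicity of the cosine transform on [0, 2]. -/

/-- The signed power `sin * |sin| ^ s`. -/
noncomputable def sinPow (s t : ℝ) : ℝ := sin t * |sin t| ^ s

lemma continuous_sinPow {s : ℝ} (hs : 0 ≤ s) : Continuous (sinPow s) := by
  unfold sinPow
  exact continuous_sin.mul (continuous_sin.abs.rpow_const fun _ => Or.inr hs)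

lemma sinPow_add_pi (s t : ℝ) : sinPow s (t + π) = -sinPow s t := by simp [sinPow]

lemma sinPow_pi_sub (s t : ℝ) : sinPow s (π - t) = sinPow s t := by simp [sinPow]

lemma abs_sinPow_le_one {s : ℝ} (hs : 0 ≤ s) (t : ℝ) : |sinPow s t| ≤ 1 := by
  rw [sinPow, abs_mul, abs_of_nonneg (a := |sin t| ^ s) (by positivity)]
  exact mul_le_one₀ (abs_sin_le_one t) (by positivity)
    (rpow_le_one (abs_nonneg _) (abs_sin_le_one t) hs)

lemma sinPow_pos {s t : ℝ} (h0 : 0 < t) (h1 : t < π) : 0 < sinPow s t := by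
  have := sin_pos_of_pos_of_lt_pi h0 h1
  rw [sinPow]
  positivity

lemma sinPow_le_of_sin_le {s u v : ℝ} (hs : 0 ≤ s) (hv : 0 ≤ sin v) (h : sin v ≤ sin u) :
    sinPow s v ≤ sinPow s u := by
  have hu := hv.trans h
  unfold sinPow
  rw [abs_of_nonneg hv, abs_of_nonneg hu]
  gcongr

/-- For x > 1 the sine changes sign at a = π/x. Reflection in a folds the negative stretch [a, π]
onto [2a - π, a], where by `hrefl` the positive part outweighs it; x < 2 leaves the interval [0, 2a
- π] nondegenerate. -/
lemma integral_mul_sin_pos {W : ℝ → ℝ} (hW : Continuous W) (hpos : ∀ u ∈ Ioo 0 π, 0 < W u)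
    {x : ℝ} (hx0 : 0 < x) (hx2 : x < 2)
    (hrefl : 1 < x → ∀ u ∈ Icc (2 * (π / x) - π) (π / x), W (2 * (π / x) - u) ≤ W u) :
    0 < ∫ u in (0 : ℝ)..π, W u * sin (x * u) := by
  have hc : Continuous fun u => W u * sin (x * u) := by fun_prop
  have hpi := pi_pos
  rcases le_or_gt x 1 with h1 | h1
  · refine intervalIntegral.intervalIntegral_pos_of_pos_on (hc.intervalIntegrable _ _)
      (fun u hu => ?_) hpi
    have h3 : x * u < π := by nlinarith [hu.1, hu.2]
    exact mul_pos (hpos u hu) (sin_pos_of_pos_of_lt_pi (mul_pos hx0 hu.1) h3)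
  · set a := π / x with ha
    have hax : x * a = π := by rw [ha]; field_simp
    have ha1 : a < π := by rw [ha, div_lt_iff₀ hx0]; nlinarith
    have ha2 : π < 2 * a := by rw [ha, ← mul_div_assoc, lt_div_iff₀ hx0]; nlinarith
    have hsin : ∀ u ∈ Ioo 0 a, 0 < sin (x * u) := fun u hu =>
      sin_pos_of_pos_of_lt_pi (mul_pos hx0 hu.1) (by rw [← hax]; gcongr; exact hu.2)
    have e1 : (∫ u in (0 : ℝ)..π, W u * sin (x * u)) =
        (∫ u in (0 : ℝ)..(2 * a - π), W u * sin (x * u)) +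
          ∫ u in (2 * a - π)..a, (W u - W (2 * a - u)) * sin (x * u) := by
      have e2 := intervalIntegral.integral_comp_sub_left (a := 2 * a - π) (b := a)
        (fun u => W u * sin (x * u)) (2 * a)
      have e3 : ∀ u, sin (x * (2 * a - u)) = -sin (x * u) := by
        intro u
        rw [mul_sub, show x * (2 * a) = 2 * π by linarith, sin_two_pi_sub]
      simp only [e3] at e2
      rw [show 2 * a - a = a by ring, show 2 * a - (2 * a - π) = π by ring] at e2
      have e4 : (∫ u in (2 * a - π)..a, (W u - W (2 * a - u)) * sin (x * u)) =
          (∫ u in (2 * a - π)..a, W u * sin (x * u)) +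
            ∫ u in (2 * a - π)..a, W (2 * a - u) * -sin (x * u) := by
        rw [← intervalIntegral.integral_add]
        · congr 1
          ext u
          ring
        · exact hc.intervalIntegrable _ _
        · exact Continuous.intervalIntegrable (by fun_prop) _ _
      rw [e4, e2, intervalIntegral.integral_add_adjacent_intervals,
        intervalIntegral.integral_add_adjacent_intervals]
      all_goals exact hc.intervalIntegrable _ _
    rw [e1]
    refine add_pos_of_pos_of_nonneg ?_ ?_
    · refine intervalIntegral.intervalIntegral_pos_of_pos_on (hc.intervalIntegrable _ _)
        (fun u hu => ?_) (by linarith)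
      exact mul_pos (hpos u ⟨hu.1, by linarith [hu.2]⟩) (hsin u ⟨hu.1, by linarith [hu.2]⟩)
    · refine intervalIntegral.integral_nonneg (by linarith) fun u hu => ?_
      refine mul_nonneg (sub_nonneg.2 (hrefl h1 u hu)) (sin_nonneg_of_nonneg_of_le_pi ?_ ?_)
      · exact mul_nonneg hx0.le (by linarith [hu.1])
      · rw [← hax]
        gcongr
        exact hu.2

lemma integrableOn_exp_mul_sinPow_mul {s l : ℝ} (hs : 0 ≤ s) (hl : 0 < l) {φ : ℝ → ℝ}
    (hφ : Continuous φ) (hb : ∀ t, |φ t| ≤ 1) :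
    IntegrableOn (fun t => exp (-l * t) * (sinPow s t * φ t)) (Ioi 0) := by
  refine (exp_neg_integrableOn_Ioi 0 hl).mul_bdd (c := 1) ?_ (ae_of_all _ fun t => ?_)
  · exact ((continuous_sinPow hs).mul hφ).aestronglyMeasurable
  · rw [norm_eq_abs, abs_mul]
    exact mul_le_one₀ (abs_sinPow_le_one hs t) (abs_nonneg _) (hb t)

lemma integral_Ioi_eq_add_shift {f : ℝ → ℝ} (hf : IntegrableOn f (Ioi 0)) {c : ℝ} (hc : 0 ≤ c) :
    ∫ t in Ioi (0 : ℝ), f t = (∫ t in (0 : ℝ)..c, f t) + ∫ t in Ioi (0 : ℝ), f (t + c) := by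
  have h := intervalIntegral.integral_interval_add_Ioi hf (hf.mono_set (Ioi_subset_Ioi hc))
  have h2 := (measurePreserving_add_right volume c).setIntegral_preimage_emb
    (measurableEmbedding_addRight c) f (Ioi c)
  rw [preimage_add_const_Ioi, sub_self] at h2
  rw [← h, h2]

/-- Let Z = B + iA be the integral with e^{ixt} in place of the sine, and Z₀ its part over [0, π].
Antiperiodicity of `sinPow` under t ↦ t + π gives Z = Z₀ - ε e^{ixπ} Z. Hence A |1 + ε e^{ixπ}|² =
Im (Z₀ (1 + ε e^{-ixπ})), which reduces positivity to one period. -/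
lemma integral_exp_mul_sinPow_mul_sin_pos {s l x : ℝ} (hs : 0 ≤ s) (hl : 0 < l) (hx0 : 0 < x)
    (hx2 : x < 2) :
    0 < ∫ t in Ioi (0 : ℝ), exp (-l * t) * (sinPow s t * sin (x * t)) := by
  have hg := continuous_sinPow hs
  have hA := integrableOn_exp_mul_sinPow_mul hs hl (φ := fun t => sin (x * t)) (by fun_prop)
    fun t => abs_sin_le_one _
  have hB := integrableOn_exp_mul_sinPow_mul hs hl (φ := fun t => cos (x * t)) (by fun_prop)
    fun t => abs_cos_le_one _
  set A := ∫ t in Ioi (0 : ℝ), exp (-l * t) * (sinPow s t * sin (x * t)) with hAd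
  set B := ∫ t in Ioi (0 : ℝ), exp (-l * t) * (sinPow s t * cos (x * t)) with hBd
  set A0 := ∫ t in (0 : ℝ)..π, exp (-l * t) * (sinPow s t * sin (x * t)) with hA0
  set B0 := ∫ t in (0 : ℝ)..π, exp (-l * t) * (sinPow s t * cos (x * t)) with hB0
  set ε := exp (-l * π) with hε
  have hpi := pi_pos
  have hε0 : 0 < ε := exp_pos _
  have hε1 : ε < 1 := by rw [hε, exp_lt_one_iff]; nlinarith
  have eA : A = A0 - ε * (cos (x * π) * A + sin (x * π) * B) := by
    have h := integral_Ioi_eq_add_shift hA hpi.le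
    have h2 : ∀ t, exp (-l * (t + π)) * (sinPow s (t + π) * sin (x * (t + π))) =
        (-ε * cos (x * π)) * (exp (-l * t) * (sinPow s t * sin (x * t))) +
        (-ε * sin (x * π)) * (exp (-l * t) * (sinPow s t * cos (x * t))) := by
      intro t
      rw [sinPow_add_pi, mul_add, mul_add, exp_add, sin_add]
      ring
    simp only [h2] at h
    rw [integral_add (hA.const_mul _) (hB.const_mul _), integral_const_mul,
      integral_const_mul] at h
    rw [← hAd, ← hBd, ← hA0] at h
    linarith
  have eB : B = B0 - ε * (cos (x * π) * B - sin (x * π) * A) := by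
    have h := integral_Ioi_eq_add_shift hB hpi.le
    have h2 : ∀ t, exp (-l * (t + π)) * (sinPow s (t + π) * cos (x * (t + π))) =
        (-ε * cos (x * π)) * (exp (-l * t) * (sinPow s t * cos (x * t))) +
        (ε * sin (x * π)) * (exp (-l * t) * (sinPow s t * sin (x * t))) := by
      intro t
      rw [sinPow_add_pi, mul_add, mul_add, exp_add, cos_add]
      ring
    simp only [h2] at h
    rw [integral_add (hB.const_mul _) (hA.const_mul _), integral_const_mul,
      integral_const_mul] at h
    rw [← hAd, ← hBd, ← hB0] at h
    linarith
  -- The substitution u ↦ π - u, under which `sinPow` is invariant, collects everything against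
  -- sin(xu) with one explicit weight.
  have hN : A0 * (1 + ε * cos (x * π)) - ε * sin (x * π) * B0 =
      ∫ u in (0 : ℝ)..π,
        (sinPow s u * (exp (-l * u) - ε * exp (-l * (π - u)))) * sin (x * u) := by
    have e2 := intervalIntegral.integral_comp_sub_left (a := 0) (b := π)
        (fun u => ε * (exp (-l * u) * (sinPow s u * sin (x * (π - u))))) π
    have e3 : (∫ u in (0 : ℝ)..π,
        (sinPow s u * (exp (-l * u) - ε * exp (-l * (π - u)))) * sin (x * u)) =
        (∫ u in (0 : ℝ)..π, exp (-l * u) * (sinPow s u * sin (x * u))) -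
        ∫ u in (0 : ℝ)..π,
          ε * (exp (-l * (π - u)) * (sinPow s (π - u) * sin (x * (π - (π - u))))) := by
      rw [← intervalIntegral.integral_sub]
      · congr 1
        ext u
        rw [sinPow_pi_sub, sub_sub_cancel]
        ring
      · exact Continuous.intervalIntegrable (by fun_prop) _ _
      · exact Continuous.intervalIntegrable (by fun_prop) _ _
    rw [e3, e2, sub_self, sub_zero, ← hA0]
    have e4 : (∫ u in (0 : ℝ)..π, ε * (exp (-l * u) * (sinPow s u * sin (x * (π - u))))) =
        (ε * sin (x * π)) * B0 - (ε * cos (x * π)) * A0 := by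
      rw [hA0, hB0, ← intervalIntegral.integral_const_mul, ← intervalIntegral.integral_const_mul,
        ← intervalIntegral.integral_sub]
      · congr 1
        ext u
        rw [mul_sub, sin_sub]
        ring
      · exact Continuous.intervalIntegrable (by fun_prop) _ _
      · exact Continuous.intervalIntegrable (by fun_prop) _ _
    rw [e4]
    ring
  have hexp : ∀ u, ε * exp (-l * (π - u)) = exp (-l * (2 * π - u)) := by
    intro u
    rw [hε, ← exp_add]
    congr 1
    ring
  have hNpos : 0 < A0 * (1 + ε * cos (x * π)) - ε * sin (x * π) * B0 := by
    rw [hN]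
    refine integral_mul_sin_pos (by fun_prop) (fun u hu => ?_) hx0 hx2 fun h1 u hu => ?_
    · refine mul_pos (sinPow_pos hu.1 hu.2) (sub_pos.2 ?_)
      rw [hexp, exp_lt_exp]
      nlinarith [hu.1, hu.2]
    · set a := π / x with ha
      have ha1 : a < π := by rw [ha, div_lt_iff₀ hx0]; nlinarith
      have ha2 : π < 2 * a := by rw [ha, ← mul_div_assoc, lt_div_iff₀ hx0]; nlinarith
      obtain ⟨hu1, hu2⟩ := hu
      have hv : 0 ≤ sin (2 * a - u) := sin_nonneg_of_nonneg_of_le_pi (by linarith) (by linarith)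
      -- Here a = π/x lies between π/2 and π, so cos a ≤ 0, and the difference of the sines is 2
      -- sin(a - u) cos a.
      have hsin : sin (2 * a - u) ≤ sin u := by
        have h3 : 0 ≤ sin (a - u) := sin_nonneg_of_nonneg_of_le_pi (by linarith) (by linarith)
        have h4 : cos a ≤ 0 := cos_nonpos_of_pi_div_two_le_of_le (by linarith) (by linarith)
        have h5 : sin (2 * a - u) - sin u = 2 * (sin (a - u) * cos a) := by
          rw [sin_sub_sin]
          rw [show (2 * a - u - u) / 2 = a - u by ring, show (2 * a - u + u) / 2 = a by ring]
          ring
        nlinarith [mul_nonpos_of_nonneg_of_nonpos h3 h4]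
      rw [hexp, hexp]
      refine mul_le_mul (sinPow_le_of_sin_le hs hv hsin) ?_ ?_ ?_
      · have h6 : exp (-l * (2 * a - u)) ≤ exp (-l * u) := exp_le_exp.2 (by nlinarith)
        have h7 : exp (-l * (2 * π - u)) ≤ exp (-l * (2 * π - (2 * a - u))) :=
          exp_le_exp.2 (by nlinarith)
        linarith
      · exact sub_nonneg.2 (exp_le_exp.2 (by nlinarith))
      · exact (sinPow_pos (by linarith) (by linarith)).le
  have hAD : A * ((1 + ε * cos (x * π)) ^ 2 + (ε * sin (x * π)) ^ 2) =
      A0 * (1 + ε * cos (x * π)) - ε * sin (x * π) * B0 := by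
    linear_combination (1 + ε * cos (x * π)) * eA - ε * sin (x * π) * eB
  rw [← hAD] at hNpos
  exact pos_of_mul_pos_left hNpos (by positivity)

/-- Writing Γ(s) t^{-s} = ∫ l^{s-1} e^{-tl} dl and exchanging integrals expresses Γ(s) times this
quantity as a positive superposition over l of the damped integrals already known to be positive. -/
lemma sincPowSin_pos {s x : ℝ} (hs : 1 < s) (hx0 : 0 < x) (hx2 : x < 2) :
    0 < sincPowSin s x := by
  have hs0 : 0 < s := by linarith
  set μ := (volume : Measure ℝ).restrict (Ioi 0) with hμ
  set f : ℝ × ℝ → ℝ := fun z => z.2 ^ (s - 1) * exp (-(z.1 * z.2)) * (sinPow s z.1 * sin (x * z.1))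
    with hf
  have hg := continuous_sinPow hs0.le
  have hmeas : AEStronglyMeasurable f (μ.prod μ) := by
    have := hg.measurable
    exact Measurable.aestronglyMeasurable (by fun_prop)
  have hker : ∀ t : ℝ, 0 < t →
      IntegrableOn (fun l : ℝ => l ^ (s - 1) * exp (-(t * l))) (Ioi 0) := by
    intro t ht
    simpa using integrableOn_rpow_mul_exp_neg_mul_rpow (s := s - 1) (p := 1) (b := t)
      (by linarith) one_pos ht
  have hG := Gamma_pos_of_pos hs0
  have hval : ∀ t : ℝ, 0 < t → ∀ c : ℝ,
      ∫ l in Ioi (0 : ℝ), l ^ (s - 1) * exp (-(t * l)) * c = Gamma s * (t⁻¹ ^ s * c) := by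
    intro t ht c
    rw [integral_mul_const, integral_rpow_mul_exp_neg_mul_Ioi hs0 ht, one_div]
    ring
  have hid : ∀ t : ℝ, 0 < t → t⁻¹ ^ s * (sinPow s t * sin (x * t)) =
      sin t * |sinc t| ^ s * sin (x * t) := by
    intro t ht
    rw [sinPow, sinc_of_ne_zero ht.ne', div_eq_mul_inv, abs_mul, abs_of_pos (inv_pos.2 ht),
      mul_rpow (abs_nonneg _) (inv_pos.2 ht).le]
    ring
  have hI := (integrable_sin_mul_abs_sinc_rpow_mul_sin hs x).integrableOn (s := Ioi 0)
  have hint : Integrable f (μ.prod μ) := by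
    rw [integrable_prod_iff hmeas]
    constructor
    · filter_upwards [ae_restrict_mem measurableSet_Ioi] with t ht
      exact (hker t ht).mul_const (sinPow s t * sin (x * t))
    · refine (hI.norm.const_mul (Gamma s)).congr ?_
      filter_upwards [ae_restrict_mem measurableSet_Ioi] with t ht
      have : ∫ l, ‖f (t, l)‖ ∂μ =
          ∫ l in Ioi (0 : ℝ), l ^ (s - 1) * exp (-(t * l)) * ‖sinPow s t * sin (x * t)‖ := by
        refine setIntegral_congr_fun measurableSet_Ioi fun l hl => ?_
        have hl' : (0 : ℝ) < l := hl
        simp only [hf]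
        rw [norm_mul, norm_of_nonneg (r := l ^ (s - 1) * exp (-(t * l))) (by positivity)]
      rw [this, hval t ht, ← hid t ht, norm_mul (t⁻¹ ^ s),
        norm_of_nonneg (rpow_nonneg (inv_pos.2 ht).le s)]
  have hswap := integral_integral_swap (f := fun t l => f (t, l)) hint
  have h1 : (∫ t, ∫ l, f (t, l) ∂μ ∂μ) = Gamma s * sincPowSin s x := by
    rw [sincPowSin, ← integral_const_mul]
    refine setIntegral_congr_fun measurableSet_Ioi fun t ht => ?_
    simp only [hf]
    rw [hval t ht, hid t ht]
  have h2 : ∀ l : ℝ, 0 < l → 0 < ∫ t, f (t, l) ∂μ := by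
    intro l hl
    have e : (∫ t, f (t, l) ∂μ) =
        l ^ (s - 1) * ∫ t in Ioi (0 : ℝ), exp (-l * t) * (sinPow s t * sin (x * t)) := by
      rw [← integral_const_mul]
      congr 1
      ext t
      simp only [hf]
      rw [show -(t * l) = -l * t by ring]
      ring
    rw [e]
    exact mul_pos (rpow_pos_of_pos hl _) (integral_exp_mul_sinPow_mul_sin_pos hs0.le hl hx0 hx2)
  have h3 : 0 < ∫ l, ∫ t, f (t, l) ∂μ ∂μ := by
    have hint2 : Integrable (fun l => ∫ t, f (t, l) ∂μ) μ := hint.integral_prod_right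
    rw [integral_pos_iff_support_of_nonneg_ae _ hint2]
    · refine lt_of_lt_of_le ?_ (measure_mono (s := Ioi (0 : ℝ)) fun l hl => (h2 l hl).ne')
      simp [hμ]
    · filter_upwards [ae_restrict_mem measurableSet_Ioi] with l hl using (h2 l hl).le
  rw [← hswap, h1] at h3
  exact pos_of_mul_pos_right h3 hG.le

lemma sincPowCos_strictAntiOn {s : ℝ} (hs : 1 < s) : StrictAntiOn (sincPowCos s) (Icc 0 2) := by
  refine strictAntiOn_of_deriv_neg (convex_Icc 0 2)
    (fun x _ => (hasDerivAt_sincPowCos hs x).continuousAt.continuousWithinAt) fun x hx => ?_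
  rw [interior_Icc] at hx
  rw [(hasDerivAt_sincPowCos hs x).deriv]
  linarith [sincPowSin_pos hs hx.1 hx.2]

/-! ### A uniform gap between the value at 1 and the values on [2, ∞). -/

lemma sincPow_eq_rpow {s t : ℝ} (h0 : 0 < t) (h1 : t < π) :
    sincPow s t = (sin t / t) ^ (s + 1) := by
  have h := div_pos (sin_pos_of_pos_of_lt_pi h0 h1) h0
  rw [sincPow, sinc_of_ne_zero h0.ne', abs_of_pos h, rpow_add_one h.ne', mul_comm]

lemma mul_cos_le_sin {t : ℝ} (h0 : 0 < t) (h1 : t < π) : t * cos t ≤ sin t := by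
  rcases le_or_gt (cos t) 0 with h | h
  · exact (mul_nonpos_of_nonneg_of_nonpos h0.le h).trans
      (sin_pos_of_pos_of_lt_pi h0 h1).le
  · have ht : t < π / 2 := by
      by_contra! hc
      exact absurd (cos_nonpos_of_pi_div_two_le_of_le hc (by linarith)) (not_le.2 h)
    have := lt_tan h0 ht
    rw [tan_eq_sin_div_cos, lt_div_iff₀ h] at this
    exact this.le

lemma exists_hasDerivAt_sincPow_nonpos {s : ℝ} (hs : 0 < s) {t : ℝ} (h0 : 0 < t) (h1 : t < π) :
    ∃ D ≤ 0, HasDerivAt (sincPow s) D t := by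
  have h := div_pos (sin_pos_of_pos_of_lt_pi h0 h1) h0
  have h2 : HasDerivAt (fun t => sin t / t) ((cos t * t - sin t * 1) / t ^ 2) t :=
    (hasDerivAt_sin t).div (hasDerivAt_id t) h0.ne'
  have h3 := h2.rpow_const (p := s + 1) (Or.inl h.ne')
  refine ⟨_, ?_, h3.congr_of_eventuallyEq ?_⟩
  · have h4 : (cos t * t - sin t * 1) / t ^ 2 ≤ 0 :=
      div_nonpos_of_nonpos_of_nonneg (by linarith [mul_cos_le_sin h0 h1]) (by positivity)
    refine mul_nonpos_of_nonpos_of_nonneg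
      (mul_nonpos_of_nonpos_of_nonneg h4 (by positivity)) (by positivity)
  · filter_upwards [Ioo_mem_nhds h0 h1] with u hu using sincPow_eq_rpow hu.1 hu.2

/-- If xt ≤ π this is concavity of sine on [0, π]. Otherwise t > π/x, and Jordan's inequality gives
sin t ≥ 2t/π > 1/x. -/
lemma sin_mul_div_le_sin {x t : ℝ} (hx : 1 ≤ x) (h0 : 0 ≤ t) (h1 : t ≤ π / 2) :
    sin (x * t) / x ≤ sin t := by
  have hx0 : 0 < x := by linarith
  have hpi := pi_pos
  rcases le_or_gt (x * t) π with h | h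
  · have hc := strictConcaveOn_sin_Icc.concaveOn.2
      (show x * t ∈ Icc 0 π from ⟨by positivity, h⟩) (show (0 : ℝ) ∈ Icc 0 π from ⟨le_rfl, hpi.le⟩)
      (show 0 ≤ x⁻¹ by positivity) (sub_nonneg.2 (inv_le_one_of_one_le₀ hx)) (by ring)
    simp only [smul_eq_mul, sin_zero, mul_zero, add_zero] at hc
    rw [inv_mul_cancel_left₀ hx0.ne'] at hc
    rw [div_eq_inv_mul]
    exact hc
  · have h2 := mul_le_sin h0 h1
    have h3 : sin (x * t) / x ≤ 1 / x := by gcongr; exact sin_le_one _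
    refine (h3.trans ?_).trans h2
    rw [div_le_iff₀ hx0, div_mul_eq_mul_div, div_mul_eq_mul_div, le_div_iff₀ hpi]
    nlinarith

lemma sin_mul_div_le_half {x t : ℝ} (hx : 2 ≤ x) : sin (x * t) / x ≤ 1 / 2 := by
  rw [div_le_div_iff₀ (by linarith) two_pos]
  linarith [sin_le_one (x * t)]

lemma sincPow_pi {s : ℝ} : sincPow s π = 0 := by
  simp [sincPow, sinc_of_ne_zero pi_ne_zero]

/-- Integration by parts: `sincPow s` decreases on (0, π), so the discarded term, its derivative
times m ≥ 0, has a favourable sign. -/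
lemma mul_sub_mul_le_integral_sincPow {s : ℝ} (hs : 0 < s) {a b : ℝ} (ha : 0 ≤ a) (hab : a ≤ b)
    (hb : b ≤ π) {m m' : ℝ → ℝ} (hm : ∀ t, HasDerivAt m (m' t) t) (hm' : Continuous m')
    (hpos : ∀ t ∈ Ioo a b, 0 ≤ m t) :
    sincPow s b * m b - sincPow s a * m a ≤ ∫ t in a..b, sincPow s t * m' t := by
  have hc := continuous_sincPow hs.le
  have hmc : Continuous m := continuous_iff_continuousAt.2 fun t => (hm t).continuousAt
  have hD : ∀ t, ∃ D, t ∈ Ioo a b → D ≤ 0 ∧ HasDerivAt (sincPow s) D t := by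
    intro t
    by_cases ht : t ∈ Ioo a b
    · obtain ⟨D, h1, h2⟩ := exists_hasDerivAt_sincPow_nonpos hs (ha.trans_lt ht.1)
        (ht.2.trans_le hb)
      exact ⟨D, fun _ => ⟨h1, h2⟩⟩
    · exact ⟨0, fun h => absurd h ht⟩
  choose D hD using hD
  refine intervalIntegral.sub_le_integral_of_hasDeriv_right_of_le (g := fun t => sincPow s t * m t)
    (g' := fun t => D t * m t + sincPow s t * m' t) hab (hc.mul hmc).continuousOn
    (fun t ht => ((hD t ht).2.mul (hm t)).hasDerivWithinAt)
    (hc.mul hm').continuousOn.integrableOn_Icc fun t ht => ?_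
  have := mul_nonpos_of_nonpos_of_nonneg (hD t ht).1 (hpos t ht)
  linarith

/-- The primitives sin t - sin(xt)/x and 1/2 - sin(xt)/x are nonnegative on the two pieces and agree
at π/6, where sin t = 1/2. The boundary terms there cancel; those at 0 and π vanish. -/
lemma integral_sincPow_mul_cos_sub_nonneg {s x : ℝ} (hs : 0 < s) (hx : 2 ≤ x) :
    0 ≤ (∫ t in (0 : ℝ)..(π / 6), sincPow s t * (cos t - cos (x * t))) +
      ∫ t in (π / 6)..π, sincPow s t * (-cos (x * t)) := by
  have hpi := pi_pos
  have hx0 : x ≠ 0 := by linarith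
  have hd : ∀ t, HasDerivAt (fun t => sin (x * t) / x) (cos (x * t)) t := by
    intro t
    have h1 : HasDerivAt (fun y : ℝ => x * y) x t := by simpa using (hasDerivAt_id t).const_mul x
    refine (h1.sin.div_const x).congr_deriv ?_
    field_simp
  have h1 := mul_sub_mul_le_integral_sincPow hs (a := 0) (b := π / 6) le_rfl (by linarith)
    (by linarith) (m := fun t => sin t - sin (x * t) / x) (m' := fun t => cos t - cos (x * t))
    (fun t => (hasDerivAt_sin t).sub (hd t)) (by fun_prop)
    (fun t ht => sub_nonneg.2 (sin_mul_div_le_sin (by linarith) ht.1.le (by linarith [ht.2])))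
  have h2 := mul_sub_mul_le_integral_sincPow hs (a := π / 6) (b := π) (by linarith) (by linarith)
    le_rfl (m := fun t => 1 / 2 - sin (x * t) / x) (m' := fun t => -cos (x * t))
    (fun t => (hd t).const_sub _) (by fun_prop)
    (fun t ht => sub_nonneg.2 (sin_mul_div_le_half hx))
  simp only [sin_pi_div_six, sincPow_pi, mul_zero, sin_zero, zero_div, sub_zero] at h1 h2
  linarith

/-- The function |sin t|^{s+2} t^{-(s+1)} vanishes at π, is nonnegative afterwards, and its
derivative is at most (s + 2) times the integrand. -/
lemma integral_Ioi_pi_sincPow_mul_cos_nonneg {s : ℝ} (hs : 0 < s) :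
    0 ≤ ∫ t in Ioi π, sincPow s t * cos t := by
  have hpi := pi_pos
  have hI : IntegrableOn (fun t => sincPow s t * cos t) (Ioi π) := by
    simpa using (integrable_sincPow_mul_cos hs 1).integrableOn
  refine ge_of_tendsto (intervalIntegral_tendsto_integral_Ioi π hI tendsto_id) ?_
  filter_upwards [eventually_ge_atTop π] with T hT
  have hd : ∀ t ∈ Ioi (0 : ℝ), HasDerivAt (fun t => |sin t| ^ (s + 2) * t ^ (-(s + 1)))
      ((s + 2) * |sin t| ^ s * sin t * cos t * t ^ (-(s + 1)) +
        |sin t| ^ (s + 2) * (-(s + 1) * t ^ (-(s + 1) - 1))) t := by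
    intro t ht
    have h1 := (hasDerivAt_abs_rpow (sin t) (p := s + 2) (by linarith)).comp t (hasDerivAt_sin t)
    rw [add_sub_cancel_right] at h1
    exact h1.mul (hasDerivAt_rpow_const (Or.inl (ne_of_gt ht)))
  have h := intervalIntegral.sub_le_integral_of_hasDeriv_right_of_le
    (φ := fun t => (s + 2) * (sincPow s t * cos t)) hT
    (fun t ht => (hd t (hpi.trans_le ht.1)).continuousAt.continuousWithinAt)
    (fun t ht => (hd t (hpi.trans ht.1)).hasDerivWithinAt)
    (((continuous_sincPow hs.le).mul continuous_cos).const_smul (s + 2)).continuousOn.integrableOn_Icc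
    (fun t ht => ?_)
  · simp only [sin_pi, abs_zero, zero_rpow (show s + 2 ≠ 0 by linarith), zero_mul, sub_zero] at h
    rw [intervalIntegral.integral_const_mul] at h
    have h2 : 0 ≤ |sin T| ^ (s + 2) * T ^ (-(s + 1)) := by
      have := hpi.trans_le hT
      positivity
    exact nonneg_of_mul_nonneg_right (h2.trans h) (by linarith)
  · have ht0 : 0 < t := hpi.trans ht.1
    have e : (s + 2) * (sincPow s t * cos t) =
        (s + 2) * |sin t| ^ s * sin t * cos t * t ^ (-(s + 1)) := by
      rw [sincPow, sinc_of_ne_zero ht0.ne', abs_div, abs_of_pos ht0, div_rpow (abs_nonneg _) ht0.le,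
        rpow_neg ht0.le, rpow_add_one ht0.ne']
      field_simp
    rw [e]
    have h3 : 0 ≤ |sin t| ^ (s + 2) * ((s + 1) * t ^ (-(s + 1) - 1)) := by positivity
    linarith

lemma integral_Ioi_pi_sinc_sq_le : ∫ t in Ioi π, sinc t ^ 2 ≤ 1 / (2 * π) + 1 / (4 * π ^ 2) := by
  have hpi := pi_pos
  have hI : IntegrableOn (fun t => sinc t ^ 2) (Ioi π) := by
    simpa using (integrable_abs_sinc_rpow (r := 2) (by norm_num)).integrableOn
  refine le_of_tendsto (intervalIntegral_tendsto_integral_Ioi π hI tendsto_id) ?_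
  filter_upwards [eventually_ge_atTop π] with T hT
  -- A near-primitive from sin² = (1 - cos 2t)/2; the added 1 in sin 2t + 1 makes the excess of its
  -- derivative over sinc² nonnegative.
  have hd : ∀ t ∈ Ioi (0 : ℝ), HasDerivAt
      (fun t => -((1 / 2) * t⁻¹ + (sin (2 * t) + 1) / 4 * (t ^ 2)⁻¹))
      (-((1 / 2) * (-(t ^ 2)⁻¹) + ((cos (2 * t) * 2 / 4) * (t ^ 2)⁻¹ +
        (sin (2 * t) + 1) / 4 * (-(2 * t) / (t ^ 2) ^ 2)))) t := by
    intro t ht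
    have ht' : t ≠ 0 := ne_of_gt ht
    have h1 : HasDerivAt (fun y : ℝ => 2 * y) 2 t := by simpa using (hasDerivAt_id t).const_mul 2
    have h2 : HasDerivAt (fun y : ℝ => y ^ 2) (2 * t) t := by simpa using hasDerivAt_pow 2 t
    exact (((hasDerivAt_inv ht').const_mul _).add
      (((h1.sin.add_const 1).div_const 4).mul (h2.inv (pow_ne_zero 2 ht')))).neg
  have h := intervalIntegral.integral_le_sub_of_hasDeriv_right_of_le
    (φ := fun t => sinc t ^ 2) hT
    (fun t ht => (hd t (hpi.trans_le ht.1)).continuousAt.continuousWithinAt)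
    (fun t ht => (hd t (hpi.trans ht.1)).hasDerivWithinAt)
    (continuous_sinc.pow 2).continuousOn.integrableOn_Icc
    (fun t ht => ?_)
  · refine h.trans ?_
    have hT0 := hpi.trans_le hT
    have h3 : 0 ≤ (1 / 2) * T⁻¹ + (sin (2 * T) + 1) / 4 * (T ^ 2)⁻¹ := by
      have := neg_one_le_sin (2 * T)
      have : 0 ≤ (sin (2 * T) + 1) / 4 := by linarith
      positivity
    rw [sin_two_pi]
    have h4 : 1 / (2 * π) + 1 / (4 * π ^ 2) = 1 / 2 * π⁻¹ + (0 + 1) / 4 * (π ^ 2)⁻¹ := by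
      field_simp
      ring
    linarith
  · have ht0 : 0 < t := hpi.trans ht.1
    rw [sinc_of_ne_zero ht0.ne', cos_two_mul, cos_sq', div_pow]
    have h5 := neg_one_le_sin (2 * t)
    have h6 : 0 ≤ (sin (2 * t) + 1) / (2 * t ^ 3) := by
      have : 0 ≤ sin (2 * t) + 1 := by linarith
      positivity
    have e : -((1 / 2) * (-(t ^ 2)⁻¹) + (((2 * (1 - sin t ^ 2) - 1) * 2 / 4) * (t ^ 2)⁻¹ +
        (sin (2 * t) + 1) / 4 * (-(2 * t) / (t ^ 2) ^ 2))) =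
        sin t ^ 2 / t ^ 2 + (sin (2 * t) + 1) / (2 * t ^ 3) := by
      field_simp
      ring
    rw [e]
    linarith

/-- The derivative of sin³ t/(3t²) is the integrand minus (2/3)(sin t/t)³. The correction is bounded
below by (2/3)(1 - t²/6)³ on [π/6, 2], where 1 - t²/6 ≥ 0, and by 0 on [2, π]. -/
lemma integral_sinc_sq_mul_cos_ge : (6 : ℝ) / 25 ≤ ∫ t in (π / 6)..π, sinc t ^ 2 * cos t := by
  have hpi := pi_pos
  have hpi1 := pi_gt_d2
  have hpi2 := pi_lt_d2
  have hc : Continuous fun t => sinc t ^ 2 * cos t := by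
    have := continuous_sinc
    fun_prop
  have hd : ∀ t ∈ Ioi (0 : ℝ), HasDerivAt (fun t => sin t ^ 3 * (3 * t ^ 2)⁻¹)
      (sinc t ^ 2 * cos t - 2 / 3 * (sin t / t) ^ 3) t := by
    intro t ht
    have ht' : t ≠ 0 := ne_of_gt ht
    have h2 : HasDerivAt (fun y : ℝ => 3 * y ^ 2) (3 * (2 * t)) t := by
      simpa using (hasDerivAt_pow 2 t).const_mul 3
    have h3 := ((hasDerivAt_sin t).pow 3).mul (h2.inv (by positivity))
    refine h3.congr_deriv ?_
    rw [sinc_of_ne_zero ht']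
    simp
    field_simp
    ring
  have hP : ∀ t, HasDerivAt (fun t : ℝ => t - t ^ 3 / 6 + t ^ 5 / 60 - t ^ 7 / 1512)
      ((1 - t ^ 2 / 6) ^ 3) t := by
    intro t
    have h := (((hasDerivAt_id t).sub ((hasDerivAt_pow 3 t).div_const 6)).add
      ((hasDerivAt_pow 5 t).div_const 60)).sub ((hasDerivAt_pow 7 t).div_const 1512)
    refine h.congr_deriv ?_
    simp
    ring
  have h1 := intervalIntegral.sub_le_integral_of_hasDeriv_right_of_le
    (a := π / 6) (b := 2) (φ := fun t => sinc t ^ 2 * cos t) (by linarith)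
    (fun t ht => ((hd t ((by linarith : (0 : ℝ) < π / 6).trans_le ht.1)).add
      ((hP t).const_mul (2 / 3))).continuousAt.continuousWithinAt)
    (fun t ht => ((hd t ((by linarith : (0 : ℝ) < π / 6).trans ht.1)).add
      ((hP t).const_mul (2 / 3))).hasDerivWithinAt)
    hc.continuousOn.integrableOn_Icc
    (fun t ht => ?_)
  · have h2 := intervalIntegral.sub_le_integral_of_hasDeriv_right_of_le
      (a := 2) (b := π) (φ := fun t => sinc t ^ 2 * cos t) (by linarith)
      (fun t ht => (hd t (two_pos.trans_le ht.1)).continuousAt.continuousWithinAt)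
      (fun t ht => (hd t (two_pos.trans ht.1)).hasDerivWithinAt)
      hc.continuousOn.integrableOn_Icc
      (fun t ht => ?_)
    · rw [← intervalIntegral.integral_add_adjacent_intervals (b := 2) (hc.intervalIntegrable _ _)
        (hc.intervalIntegrable _ _)]
      simp only [Pi.add_apply, sin_pi_div_six, sin_pi] at h1 h2
      have h3 : (1 / 2 : ℝ) ^ 3 * (3 * (π / 6) ^ 2)⁻¹ ≤ 153 / 1000 := by
        rw [← div_eq_mul_inv, div_le_iff₀ (by positivity)]
        nlinarith
      have h4 : π / 6 - (π / 6) ^ 3 / 6 + (π / 6) ^ 5 / 60 - (π / 6) ^ 7 / 1512 ≤ 0.525 := by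
        have h5 : 0 ≤ (π / 6) ^ 7 := by positivity
        have h6 : (π / 6) ^ 5 ≤ (π / 6) ^ 3 := pow_le_pow_of_le_one (by positivity)
          (by linarith) (by norm_num)
        have h7 : 0 ≤ (π / 6) ^ 3 := by positivity
        linarith
      norm_num at h1 h2 h3 h4 ⊢
      linarith
    · have h : 0 ≤ sin t := sin_nonneg_of_nonneg_of_le_pi (by linarith [ht.1]) ht.2.le
      have ht0 : 0 < t := by linarith [ht.1]
      have : 0 ≤ 2 / 3 * (sin t / t) ^ 3 := by positivity
      linarith
  · have ht0 : 0 < t := by linarith [ht.1]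
    have h8 : 1 - t ^ 2 / 6 ≤ sin t / t := by
      rw [le_div_iff₀ ht0]
      have := sin_gt_sub_cube ht0
      nlinarith
    have h9 : 0 ≤ 1 - t ^ 2 / 6 := by nlinarith [ht.2]
    have h10 := pow_le_pow_left₀ h9 h8 3
    linarith

/-- Split the half-line at π/6 and π. The difference of the values at 1 and x contains nonnegative
contributions, the main term ∫ `sincPow` · cos over [π/6, π], at least (2/π)^{s-1} · 6/25, and minus
the tail at x, which is at most (1/π)^{s-1} · 19/100. -/
lemma exists_sincPowCos_le_sub {s : ℝ} (hs : 1 < s) :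
    ∃ d > 0, ∀ x, 2 ≤ x → sincPowCos s x ≤ sincPowCos s 1 - d := by
  have hpi := pi_pos
  have hpi1 := pi_gt_d2
  have hs0 : 0 < s := by linarith
  have hc := continuous_sincPow hs0.le
  have hA : (2 / π) ^ (s - 1) * (6 / 25) ≤ ∫ t in (π / 6)..π, sincPow s t * cos t := by
    refine (mul_le_mul_of_nonneg_left integral_sinc_sq_mul_cos_ge (by positivity)).trans ?_
    rw [← intervalIntegral.integral_const_mul]
    have := continuous_sinc
    refine intervalIntegral.integral_mono_on_of_le_Ioo (by linarith)
      (Continuous.intervalIntegrable (by fun_prop) _ _)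
      (Continuous.intervalIntegrable (by fun_prop) _ _) fun t ht => ?_
    have ht0 : 0 < t := by linarith [ht.1]
    have hsin := sin_pos_of_pos_of_lt_pi ht0 ht.2
    have e : sincPow s t = (sin t / t) ^ (s - 1) * sinc t ^ 2 := by
      rw [sincPow_eq_rpow ht0 ht.2, sinc_of_ne_zero ht0.ne',
        show s + 1 = (s - 1) + (2 : ℕ) by push_cast; ring, rpow_add_natCast (by positivity)]
    rw [e, mul_assoc]
    have hsq : 0 ≤ sinc t ^ 2 := by positivity
    -- At π/2 the cosine changes sign and sin t/t equals 2/π, so replacing (sin t/t)^{s-1} by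
    -- (2/π)^{s-1} lowers the integrand on both sides.
    rcases le_total t (π / 2) with h | h
    · have hcos : 0 ≤ cos t := cos_nonneg_of_neg_pi_div_two_le_of_le (by linarith) h
      have h2 : 2 / π ≤ sin t / t := by
        rw [le_div_iff₀ ht0]
        exact mul_le_sin ht0.le h
      have h3 : (2 / π) ^ (s - 1) ≤ (sin t / t) ^ (s - 1) :=
        rpow_le_rpow (by positivity) h2 (by linarith)
      exact mul_le_mul_of_nonneg_right h3 (by positivity)
    · have hcos : cos t ≤ 0 := cos_nonpos_of_pi_div_two_le_of_le h (by linarith [ht.2])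
      have h2 : sin t / t ≤ 2 / π := by
        rw [div_le_div_iff₀ ht0 hpi]
        nlinarith [sin_le_one t]
      have h3 : (sin t / t) ^ (s - 1) ≤ (2 / π) ^ (s - 1) :=
        rpow_le_rpow (by positivity) h2 (by linarith)
      exact mul_le_mul_of_nonpos_right h3 (mul_nonpos_of_nonneg_of_nonpos hsq hcos)
  have hIsq : Integrable (fun t => sinc t ^ 2) := by
    simpa using integrable_abs_sinc_rpow (r := 2) (by norm_num)
  have hB : ∀ x : ℝ, (∫ t in Ioi π, sincPow s t * cos (x * t)) ≤ (1 / π) ^ (s - 1) * (19 / 100) := by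
    intro x
    have h1 : (∫ t in Ioi π, sincPow s t * cos (x * t)) ≤
        ∫ t in Ioi π, (1 / π) ^ (s - 1) * sinc t ^ 2 := by
      refine setIntegral_mono_on (integrable_sincPow_mul_cos hs0 x).integrableOn
        (hIsq.const_mul _).integrableOn measurableSet_Ioi fun t ht => ?_
      have ht0 : 0 < t := hpi.trans ht
      have ht1 : π < t := ht
      calc sincPow s t * cos (x * t) ≤ |sincPow s t| * |cos (x * t)| := by
            rw [← abs_mul]; exact le_abs_self _
        _ ≤ |sincPow s t| * 1 := by gcongr; exact abs_cos_le_one _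
        _ = |sinc t| ^ (s - 1) * sinc t ^ 2 := by
            rw [mul_one, abs_sincPow hs0, show s + 1 = (s - 1) + (2 : ℕ) by push_cast; ring,
              rpow_add_natCast' (abs_nonneg _) (by push_cast; linarith), sq_abs]
        _ ≤ _ := by
            refine mul_le_mul_of_nonneg_right (rpow_le_rpow (abs_nonneg _) ?_ (by linarith))
              (by positivity)
            rw [sinc_of_ne_zero ht0.ne', abs_div, abs_of_pos ht0, div_le_div_iff₀ ht0 hpi]
            nlinarith [abs_sin_le_one t]
    refine h1.trans ?_
    rw [integral_const_mul]
    refine mul_le_mul_of_nonneg_left (integral_Ioi_pi_sinc_sq_le.trans ?_) (by positivity)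
    have h3 : 1 / (2 * π) ≤ 1 / 6.28 := by gcongr; linarith
    have h4 : 1 / (4 * π ^ 2) ≤ 1 / (4 * 3.14 ^ 2) := by gcongr
    refine (add_le_add h3 h4).trans (by norm_num)
  have hhalf : ∀ x, sincPowCos s x = 2 * ∫ t in Ioi (0 : ℝ), sincPow s t * cos (x * t) := by
    intro x
    rw [sincPowCos, ← integral_comp_abs (f := fun t => sincPow s t * cos (x * t))]
    congr 1
    ext t
    rcases abs_choice t with h | h <;> rw [h]
    simp [sincPow_neg]
  have hsplit : ∀ x, (∫ t in Ioi (0 : ℝ), sincPow s t * cos (x * t)) =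
      (∫ t in (0 : ℝ)..(π / 6), sincPow s t * cos (x * t)) +
      (∫ t in (π / 6)..π, sincPow s t * cos (x * t)) +
      ∫ t in Ioi π, sincPow s t * cos (x * t) := by
    intro x
    have hI := integrable_sincPow_mul_cos hs0 x
    rw [intervalIntegral.integral_add_adjacent_intervals hI.intervalIntegrable
      hI.intervalIntegrable, intervalIntegral.integral_interval_add_Ioi hI.integrableOn
      hI.integrableOn]
  refine ⟨2 * ((2 / π) ^ (s - 1) * (6 / 25) - (1 / π) ^ (s - 1) * (19 / 100)), ?_, fun x hx => ?_⟩
  · have h1 : (1 / π) ^ (s - 1) ≤ (2 / π) ^ (s - 1) :=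
      rpow_le_rpow (by positivity) (by gcongr; norm_num) (by linarith)
    have h2 : 0 < (1 / π) ^ (s - 1) := by positivity
    linarith
  · have h1 := hsplit 1
    have h2 := hsplit x
    have h3 := integral_sincPow_mul_cos_sub_nonneg hs0 hx
    have h4 := integral_Ioi_pi_sincPow_mul_cos_nonneg hs0
    have h5 := hB x
    simp only [one_mul] at h1
    have h6 : (∫ t in (0 : ℝ)..(π / 6), sincPow s t * (cos t - cos (x * t))) =
        (∫ t in (0 : ℝ)..(π / 6), sincPow s t * cos t) -
          ∫ t in (0 : ℝ)..(π / 6), sincPow s t * cos (x * t) := by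
      rw [← intervalIntegral.integral_sub]
      · simp only [mul_sub]
      · exact Continuous.intervalIntegrable (by fun_prop) _ _
      · exact Continuous.intervalIntegrable (by fun_prop) _ _
    simp only [mul_neg, intervalIntegral.integral_neg] at h3
    have h7 := hhalf x
    have h8 := hhalf 1
    simp only [one_mul] at h8
    linarith

/-! ### The kernel `K` and its linear gap at ±1. -/

lemma unitBall_eq_Icc : unitBall = Icc (-1) 1 := by
  ext x
  simp [unitBall, abs_le]

lemma indicatorHat_unitBall (ξ : ℝ) : indicatorHat unitBall ξ = ((2 * sinc (2 * π * ξ) : ℝ) : ℂ) := by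
  have h1 : indicatorHat unitBall ξ =
      ∫ v in (-1 : ℝ)..1, Complex.exp (((-(2 * π * ξ)) * v : ℝ) * Complex.I) := by
    rw [indicatorHat, fourier_real_eq_integral_exp_smul, unitBall_eq_Icc,
      intervalIntegral.integral_of_le (by norm_num), ← integral_Icc_eq_integral_Ioc,
      ← integral_indicator measurableSet_Icc]
    congr 1
    ext v
    by_cases hv : v ∈ Icc (-1 : ℝ) 1
    · rw [indicator_of_mem hv, indicator_of_mem hv, smul_eq_mul, mul_one]
      congr 3
      ring
    · rw [indicator_of_notMem hv, indicator_of_notMem hv, smul_zero]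
  rw [h1]
  rcases eq_or_ne ξ 0 with rfl | hξ
  · simp
    norm_num
  · have hr : 2 * π * ξ ≠ 0 := by positivity
    rw [intervalIntegral.integral_comp_mul_left (fun v : ℝ => Complex.exp (v * Complex.I))
      (neg_ne_zero.2 hr), mul_neg_one, neg_neg, mul_one, intervalIntegral.integral_symm,
      integral_exp_mul_I_eq_sinc, Complex.real_smul]
    have hr' : ((2 * π * ξ : ℝ) : ℂ) ≠ 0 := by exact_mod_cast hr
    rw [neg_inv.symm, Complex.ofReal_neg, Complex.ofReal_inv]
    field_simp
    push_cast
    ring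

/-- The real function whose inverse Fourier transform is `K q`. -/
noncomputable def weight (q ξ : ℝ) : ℝ :=
  2 * sinc (2 * π * ξ) * |2 * sinc (2 * π * ξ)| ^ (q - 2)

lemma weight_eq {q : ℝ} (ξ : ℝ) :
    weight q ξ = 2 * 2 ^ (q - 2) * sincPow (q - 2) (2 * π * ξ) := by
  rw [weight, sincPow, abs_mul, mul_rpow (abs_nonneg _) (abs_nonneg _), abs_two]
  ring

lemma integrable_weight {q : ℝ} (hq : 2 < q) : Integrable (weight q) := by
  have h := ((integrable_sincPow (s := q - 2) (by linarith)).comp_mul_left'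
    (R := 2 * π) (by positivity)).const_mul (2 * 2 ^ (q - 2))
  exact h.congr (ae_of_all _ fun ξ => (weight_eq ξ).symm)

lemma integrable_cexp_smul {f : ℝ → ℝ} (hf : Integrable f) {g : ℝ → ℝ} (hg : Continuous g) :
    Integrable (fun x => Complex.exp (g x * Complex.I) • (f x : ℂ)) := by
  refine (hf.ofReal (𝕜 := ℂ)).bdd_mul (c := 1) ?_ (ae_of_all _ fun x => ?_)
  · exact Continuous.aestronglyMeasurable (by fun_prop)
  · exact (Complex.norm_exp_ofReal_mul_I _).le

lemma re_integral_cexp_smul {f : ℝ → ℝ} (hf : Integrable f) {g : ℝ → ℝ} (hg : Continuous g) :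
    (∫ x, Complex.exp (g x * Complex.I) • (f x : ℂ)).re = ∫ x, f x * cos (g x) := by
  have h := Complex.reCLM.integral_comp_comm (integrable_cexp_smul hf hg)
  simp only [Complex.reCLM_apply] at h
  rw [← h]
  congr 1
  ext x
  rw [smul_eq_mul, Complex.re_mul_ofReal, Complex.exp_ofReal_mul_I_re, mul_comm]

lemma re_fourier_ofReal {f : ℝ → ℝ} (hf : Integrable f) (ξ : ℝ) :
    (𝓕 (fun x => (f x : ℂ)) ξ).re = ∫ x, f x * cos (2 * π * x * ξ) := by
  rw [fourier_real_eq_integral_exp_smul, re_integral_cexp_smul hf (by fun_prop)]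
  congr 1
  ext x
  rw [← cos_neg]
  congr 2
  ring

lemma K_eq_integral {q : ℝ} (hq : 2 < q) (x : ℝ) :
    K q x = ∫ ξ, weight q ξ * cos (2 * π * x * ξ) := by
  have h1 : (fun ξ : ℝ =>
      indicatorHat unitBall ξ * ((‖indicatorHat unitBall ξ‖ ^ (q - 2) : ℝ) : ℂ)) =
      fun ξ => (weight q ξ : ℂ) := by
    ext ξ
    rw [indicatorHat_unitBall, Complex.norm_real, norm_eq_abs, ← Complex.ofReal_mul, weight]
  rw [K, h1, fourierInv_eq', re_integral_cexp_smul (integrable_weight hq) (by fun_prop)]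
  congr 1
  ext ξ
  congr 2
  simp
  ring

lemma K_eq_sincPowCos {q : ℝ} (hq : 2 < q) (x : ℝ) :
    K q x = (2 * 2 ^ (q - 2) * (2 * π)⁻¹) * sincPowCos (q - 2) x := by
  have h : (fun ξ => weight q ξ * cos (2 * π * x * ξ)) =
      fun ξ => (2 * 2 ^ (q - 2)) * (fun t => sincPow (q - 2) t * cos (x * t)) (2 * π * ξ) := by
    ext ξ
    rw [weight_eq, show 2 * π * x * ξ = x * (2 * π * ξ) by ring]
    ring
  rw [K_eq_integral hq, h, integral_const_mul,
    Measure.integral_comp_mul_left (fun t => sincPow (q - 2) t * cos (x * t)), sincPowCos,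
    smul_eq_mul, abs_of_pos (by positivity)]
  ring

/-- `sincPowCos s` separates `|x| < 1` from `|x| > 1` at a linear rate. -/
lemma exists_sincPowCos_gap {s : ℝ} (hs : 1 < s) :
    ∃ κ > 0, ∀ x, 0 ≤ x →
      (x ≤ 1 → κ * (1 - x) ≤ sincPowCos s x - sincPowCos s 1) ∧
      (1 ≤ x → κ * min 1 (x - 1) ≤ sincPowCos s 1 - sincPowCos s x) := by
  obtain ⟨d, hd, hd2⟩ := exists_sincPowCos_le_sub hs
  have hanti := sincPowCos_strictAntiOn hs
  set M := sincPowCos s with hM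
  -- The slope at 1 is -2F, so the decrease has rate at least F on some [1 - r, 1 + r]. Monotonicity
  -- carries the gap Fr to the rest of [0, 2], and d serves beyond 2.
  have hF := sincPowSin_pos hs one_pos one_lt_two
  set F := sincPowSin s 1 with hFd
  have hder := hasDerivAt_iff_isLittleO.1 (hasDerivAt_sincPowCos hs 1)
  obtain ⟨ε, hε, hε2⟩ := Metric.eventually_nhds_iff.1 (hder.def hF)
  simp only [smul_eq_mul, norm_eq_abs, dist_eq] at hε2
  obtain ⟨r, hr0, hrε, hr1⟩ : ∃ r > 0, r < ε ∧ r < 1 :=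
    ⟨min (ε / 2) (1 / 2), by positivity, (min_le_left _ _).trans_lt (by linarith),
      (min_le_right _ _).trans_lt (by norm_num)⟩
  have hin : ∀ y, 1 - r ≤ y → y ≤ 1 → F * (1 - y) ≤ M y - M 1 := by
    intro y h1 h2
    have h := hε2 (y := y) (by rw [abs_of_nonpos (by linarith)]; linarith)
    rw [abs_of_nonpos (a := y - 1) (by linarith)] at h
    have := (abs_le.1 h).1
    simp only [← hM, ← hFd] at this
    linarith
  have hout : ∀ y, 1 ≤ y → y ≤ 1 + r → F * (y - 1) ≤ M 1 - M y := by
    intro y h1 h2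
    have h := hε2 (y := y) (by rw [abs_of_nonneg (by linarith)]; linarith)
    rw [abs_of_nonneg (a := y - 1) (by linarith)] at h
    have := (abs_le.1 h).2
    simp only [← hM, ← hFd] at this
    linarith
  refine ⟨min (F * r) d, by positivity, fun x hx0 => ⟨fun hx => ?_, fun hx => ?_⟩⟩
  · have hκ : min (F * r) d ≤ F * r := min_le_left _ _
    rcases le_total (1 - r) x with h | h
    · refine le_trans ?_ (hin x h hx)
      refine mul_le_mul_of_nonneg_right (hκ.trans ?_) (by linarith)
      nlinarith
    · have h1 := hin (1 - r) le_rfl (by linarith)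
      have h2 := hanti.antitoneOn (a := x) (b := 1 - r) ⟨hx0, by linarith⟩
        ⟨by linarith, by linarith⟩ h
      have h3 : min (F * r) d * (1 - x) ≤ F * r * 1 :=
        mul_le_mul hκ (by linarith) (by linarith) (by positivity)
      linarith
  · have hm0 : 0 ≤ min 1 (x - 1) := le_min zero_le_one (by linarith)
    rcases le_total 2 x with h2 | h2
    · have h3 : min (F * r) d * min 1 (x - 1) ≤ d * 1 :=
        mul_le_mul (min_le_right _ _) (min_le_left _ _) hm0 hd.le
      linarith [hd2 x h2]
    · have hκ : min (F * r) d ≤ F * r := min_le_left _ _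
      rcases le_total x (1 + r) with h | h
      · refine le_trans ?_ (hout x hx h)
        refine mul_le_mul (hκ.trans ?_) (min_le_right _ _) hm0 hF.le
        nlinarith
      · have h1 := hout (1 + r) (by linarith) le_rfl
        have h2 := hanti.antitoneOn (a := 1 + r) (b := x) ⟨by linarith, by linarith⟩
          ⟨by linarith, by linarith⟩ h
        have h3 : min (F * r) d * min 1 (x - 1) ≤ F * r * 1 :=
          mul_le_mul hκ (min_le_left _ _) hm0 (by positivity)
        linarith

lemma exists_K_gap {q : ℝ} (hq : 3 < q) :
    ∃ κ > 0, ∀ x, (|x| ≤ 1 → κ * min 1 (abs (|x| - 1)) ≤ K q x - K q 1) ∧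
      (1 ≤ |x| → κ * min 1 (abs (|x| - 1)) ≤ K q 1 - K q x) := by
  obtain ⟨κ, hκ, h⟩ := exists_sincPowCos_gap (s := q - 2) (by linarith)
  have hc : 0 < 2 * (2 : ℝ) ^ (q - 2) * (2 * π)⁻¹ := by positivity
  refine ⟨2 * 2 ^ (q - 2) * (2 * π)⁻¹ * κ, by positivity, fun x => ?_⟩
  obtain ⟨h1, h2⟩ := h |x| (abs_nonneg x)
  rw [K_eq_sincPowCos (by linarith), K_eq_sincPowCos (by linarith), ← mul_sub, ← mul_sub, mul_assoc,
    ← sincPowCos_abs _ x]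
  constructor <;> intro hx
  · refine mul_le_mul_of_nonneg_left ((mul_le_mul_of_nonneg_left ?_ hκ.le).trans (h1 hx)) hc.le
    rw [abs_of_nonpos (by linarith)]
    exact (min_le_right _ _).trans (by linarith)
  · refine mul_le_mul_of_nonneg_left ((mul_le_mul_of_nonneg_left ?_ hκ.le).trans (h2 hx)) hc.le
    rw [abs_of_nonneg (by linarith)]

/-! ### Second-order expansion of the q-th power of the modulus. -/

lemma rpow_sub_rpow_le_mul_sub {u v r : ℝ} (hu : 0 ≤ u) (hv : 0 ≤ v) (hr : 1 ≤ r) :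
    u ^ r - v ^ r ≤ r * u ^ (r - 1) * (u - v) := by
  rcases hu.eq_or_lt with rfl | hu
  · rw [zero_rpow (by linarith)]
    rcases hr.eq_or_lt with rfl | hr
    · simp
    · rw [zero_rpow (by linarith)]
      have := rpow_nonneg hv r
      linarith
  · have h := one_add_mul_self_le_rpow_one_add (s := v / u - 1)
      (by have := div_nonneg hv hu.le; linarith) hr
    rw [add_sub_cancel, div_rpow hv hu.le, le_div_iff₀ (by positivity)] at h
    have e : u ^ r = u ^ (r - 1) * u := by rw [← rpow_add_one hu.ne', sub_add_cancel]
    have e2 : (1 + r * (v / u - 1)) * u ^ r = u ^ r + r * u ^ (r - 1) * (v - u) := by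
      rw [e]
      field_simp
    rw [e2] at h
    linarith

lemma abs_rpow_sub_rpow_le {u v c r : ℝ} (hu : 0 ≤ u) (hv : 0 ≤ v) (huc : u ≤ c) (hvc : v ≤ c)
    (hr : 1 ≤ r) : |u ^ r - v ^ r| ≤ r * c ^ (r - 1) * |u - v| := by
  have hc : 0 ≤ c := hu.trans huc
  have key : ∀ a b : ℝ, 0 ≤ a → 0 ≤ b → a ≤ c → a ^ r - b ^ r ≤ r * c ^ (r - 1) * |a - b| := by
    intro a b ha hb hac
    refine (rpow_sub_rpow_le_mul_sub ha hb hr).trans ?_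
    have h1 : a ^ (r - 1) ≤ c ^ (r - 1) := rpow_le_rpow ha hac (by linarith)
    have h2 : 0 ≤ a ^ (r - 1) := rpow_nonneg ha _
    calc r * a ^ (r - 1) * (a - b) ≤ r * a ^ (r - 1) * |a - b| := by
          gcongr
          exact le_abs_self _
      _ ≤ _ := by gcongr
  rw [abs_le]
  constructor
  · have := key v u hv hu hvc
    rw [abs_sub_comm] at this
    linarith
  · exact key u v hu hv huc

/-- Second order expansion of `|·| ^ q` about a real point. -/
lemma norm_add_rpow_le {q : ℝ} (hq : 3 ≤ q) (a : ℝ) (w : ℂ) :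
    ‖(a : ℂ) + w‖ ^ q ≤ |a| ^ q + q * (a * |a| ^ (q - 2) * w.re) +
      (q / 2 + q * (q - 2) * 2 ^ (q - 2)) * (|a| ^ (q - 2) * ‖w‖ ^ 2 + ‖w‖ ^ q) := by
  set U := ‖(a : ℂ) + w‖ with hU
  set W := ‖w‖ with hW
  have hU0 : 0 ≤ U := norm_nonneg _
  have hW0 : 0 ≤ W := norm_nonneg _
  have hA0 : 0 ≤ |a| := abs_nonneg a
  have hsq : U ^ 2 - |a| ^ 2 = 2 * a * w.re + W ^ 2 := by
    rw [hU, hW, ← Complex.normSq_eq_norm_sq, ← Complex.normSq_eq_norm_sq, Complex.normSq_apply,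
      Complex.normSq_apply, sq_abs]
    simp
    ring
  have hUA : U ≤ |a| + W := by
    refine (norm_add_le _ _).trans ?_
    rw [Complex.norm_real, norm_eq_abs]
  have hd : abs (U - |a|) ≤ W := by
    have := abs_norm_sub_norm_le ((a : ℂ) + w) (a : ℂ)
    rwa [add_sub_cancel_left, Complex.norm_real, norm_eq_abs] at this
  -- Convexity of z ↦ z^{q/2} is applied to squared moduli, because U² - |a|² is exactly 2a Re w +
  -- |w|². Replacing U^{q-2} by |a|^{q-2} then costs only quadratic terms.
  have h1 : U ^ q - |a| ^ q ≤ q / 2 * U ^ (q - 2) * (U ^ 2 - |a| ^ 2) := by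
    have h := rpow_sub_rpow_le_mul_sub (u := U ^ 2) (v := |a| ^ 2) (r := q / 2) (by positivity)
      (by positivity) (by linarith)
    have e : ∀ z : ℝ, 0 ≤ z → ∀ r : ℝ, (z ^ 2) ^ r = z ^ (2 * r) := by
      intro z hz r
      rw [← rpow_natCast z 2, ← rpow_mul hz]
      norm_num
    rw [e _ hU0, e _ hA0, e _ hU0, show 2 * (q / 2) = q by ring,
      show 2 * (q / 2 - 1) = q - 2 by ring] at h
    exact h
  have h2 : |U ^ (q - 2) - |a| ^ (q - 2)| ≤ (q - 2) * (|a| + W) ^ (q - 2 - 1) * W := by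
    refine (abs_rpow_sub_rpow_le hU0 hA0 hUA (by linarith) (by linarith)).trans ?_
    have : 0 ≤ q - 2 := by linarith
    gcongr
  have h3 : |U ^ 2 - |a| ^ 2| ≤ W * (2 * (|a| + W)) := by
    rw [show U ^ 2 - |a| ^ 2 = (U - |a|) * (U + |a|) by ring, abs_mul,
      abs_of_nonneg (a := U + |a|) (by positivity)]
    gcongr
    linarith
  have h4 : (U ^ (q - 2) - |a| ^ (q - 2)) * (U ^ 2 - |a| ^ 2) ≤
      2 * (q - 2) * (|a| + W) ^ (q - 2) * W ^ 2 := by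
    refine (le_abs_self _).trans ?_
    rw [abs_mul]
    have h5 : 0 ≤ (q - 2) * (|a| + W) ^ (q - 2 - 1) * W := (abs_nonneg _).trans h2
    refine (mul_le_mul h2 h3 (abs_nonneg _) h5).trans (le_of_eq ?_)
    have e : (|a| + W) ^ (q - 2) = (|a| + W) ^ (q - 2 - 1) * (|a| + W) := by
      rw [← rpow_add_one' (by positivity) (by linarith), sub_add_cancel]
    rw [e]
    ring
  have h6 : (|a| + W) ^ (q - 2) ≤ 2 ^ (q - 2) * (|a| ^ (q - 2) + W ^ (q - 2)) := by
    have h7 : |a| + W ≤ 2 * max |a| W := by linarith [le_max_left |a| W, le_max_right |a| W]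
    refine (rpow_le_rpow (by positivity) h7 (by linarith)).trans ?_
    rw [mul_rpow zero_le_two (by positivity)]
    gcongr
    have := rpow_nonneg hA0 (q - 2)
    have := rpow_nonneg hW0 (q - 2)
    rcases max_choice |a| W with h | h <;> rw [h] <;> linarith
  have h8 : W ^ q = W ^ (q - 2) * W ^ 2 := by
    rw [← rpow_natCast W 2, ← rpow_add_of_nonneg hW0 (by linarith) (by positivity)]
    norm_num
  have h9 : (|a| + W) ^ (q - 2) * W ^ 2 ≤ 2 ^ (q - 2) * (|a| ^ (q - 2) * W ^ 2 + W ^ q) := by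
    rw [h8, ← add_mul, ← mul_assoc]
    gcongr
  have h10 : q / 2 * U ^ (q - 2) * (U ^ 2 - |a| ^ 2) =
      q * (a * |a| ^ (q - 2) * w.re) + q / 2 * (|a| ^ (q - 2) * W ^ 2) +
        q / 2 * ((U ^ (q - 2) - |a| ^ (q - 2)) * (U ^ 2 - |a| ^ 2)) := by
    rw [hsq]
    ring
  have h11 : 0 ≤ q / 2 * W ^ q := by positivity
  have h12 : q / 2 * ((U ^ (q - 2) - |a| ^ (q - 2)) * (U ^ 2 - |a| ^ 2)) ≤
      q * (q - 2) * 2 ^ (q - 2) * (|a| ^ (q - 2) * W ^ 2 + W ^ q) := by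
    have h13 : q / 2 * (2 * (q - 2) * (|a| + W) ^ (q - 2) * W ^ 2) =
        q * (q - 2) * ((|a| + W) ^ (q - 2) * W ^ 2) := by ring
    calc _ ≤ q / 2 * (2 * (q - 2) * (|a| + W) ^ (q - 2) * W ^ 2) := by gcongr
      _ = _ := h13
      _ ≤ q * (q - 2) * (2 ^ (q - 2) * (|a| ^ (q - 2) * W ^ 2 + W ^ q)) := by
          have : 0 ≤ q - 2 := by linarith
          gcongr
      _ = _ := by ring
  linarith

/-! ### Plancherel for integrable, square-integrable functions. -/

lemma continuous_fourier {f : ℝ → ℂ} (hf : Integrable f) : Continuous (𝓕 f) :=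
  VectorFourier.fourierIntegral_continuous continuous_fourierChar
    (by exact continuous_inner) hf

/-- Plancherel's theorem for the Fourier integral of functions in `L¹ ∩ L²`. -/
lemma fourier_ae_eq_of_memLp_two {f : ℝ → ℂ} (hf : Integrable f) (hf2 : MemLp f 2) :
    ((𝓕 (hf2.toLp f) : Lp ℂ 2 (volume : Measure ℝ)) : ℝ → ℂ) =ᵐ[volume] 𝓕 f := by
  -- Both transforms are tested against smooth compactly supported functions: the L² one agrees with
  -- the distributional one, and the integral one moves across by self-adjointness.
  refine ae_eq_of_integral_contDiff_smul_eq ((Lp.memLp _).locallyIntegrable (by norm_num))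
    (continuous_fourier hf).locallyIntegrable fun g hg hgc => ?_
  have hg1 : HasCompactSupport (Complex.ofRealCLM ∘ g) := hgc.comp_left rfl
  have hg2 : ContDiff ℝ ((⊤ : ℕ∞) : WithTop ℕ∞) (Complex.ofRealCLM ∘ g) := by fun_prop
  set ψ := hg1.toSchwartzMap hg2 with hψ
  have hψg : ∀ x, ψ x = (g x : ℂ) := fun x => rfl
  have h := congrArg (fun T => T ψ) (Lp.fourier_toTemperedDistribution_eq (hf2.toLp f))
  simp only [TemperedDistribution.fourier_apply, Lp.toTemperedDistribution_apply] at h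
  have h2 : (∫ x, (𝓕 ψ : SchwartzMap ℝ ℂ) x • (hf2.toLp f : ℝ → ℂ) x) =
      ∫ x, (𝓕 (ψ : ℝ → ℂ)) x • f x := by
    refine integral_congr_ae ?_
    filter_upwards [hf2.coeFn_toLp] with x hx
    rw [hx, SchwartzMap.fourier_coe]
  have h3 : (∫ x, (𝓕 (ψ : ℝ → ℂ)) x • f x) = ∫ x, ψ x • 𝓕 f x := by
    have := VectorFourier.integral_fourierIntegral_smul_eq_flip (L := innerₗ ℝ) (μ := volume)
      (ν := volume) (f := (ψ : ℝ → ℂ)) (g := f) continuous_fourierChar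
      (by exact continuous_inner) ψ.integrable hf
    rw [flip_innerₗ] at this
    exact this
  rw [h2, h3] at h
  simp only [hψg, Complex.coe_smul] at h
  exact h.symm

lemma integrable_norm_fourier_sq {f : ℝ → ℂ} (hf : Integrable f) (hf2 : MemLp f 2) :
    Integrable (fun ξ => ‖𝓕 f ξ‖ ^ 2) ∧ ∫ ξ, ‖𝓕 f ξ‖ ^ 2 = ∫ x, ‖f x‖ ^ 2 := by
  have hae := fourier_ae_eq_of_memLp_two hf hf2
  have hm : MemLp (𝓕 f) 2 := (Lp.memLp _).ae_eq hae
  refine ⟨(memLp_two_iff_integrable_sq_norm hm.1).1 hm, ?_⟩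
  have h1 : eLpNorm (𝓕 f) 2 volume = eLpNorm f 2 volume := by
    have h := Lp.norm_fourier_eq (hf2.toLp f)
    rw [Lp.norm_def, Lp.norm_def, eLpNorm_congr_ae hae, eLpNorm_congr_ae hf2.coeFn_toLp] at h
    exact (ENNReal.toReal_eq_toReal_iff' hm.2.ne hf2.2.ne).1 h
  rw [hm.eLpNorm_eq_integral_rpow_norm two_ne_zero ENNReal.ofNat_ne_top,
    hf2.eLpNorm_eq_integral_rpow_norm two_ne_zero ENNReal.ofNat_ne_top] at h1
  simp only [ENNReal.toReal_ofNat, rpow_ofNat] at h1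
  have hn : ∀ g : ℝ → ℂ, 0 ≤ ∫ x, ‖g x‖ ^ 2 := fun g => integral_nonneg fun x => by positivity
  rw [ENNReal.ofReal_eq_ofReal_iff (rpow_nonneg (hn _) _) (rpow_nonneg (hn _) _)] at h1
  exact (rpow_left_inj (hn _) (hn _) (by norm_num)).1 h1

/-! ### Mass near the endpoints and bounds on the transform of the perturbation. -/

/-- The distance to the endpoints `±1` of the unit ball, truncated at `1`. -/
noncomputable def edgeDist (x : ℝ) : ℝ := min 1 (abs (|x| - 1))

lemma edgeDist_nonneg (x : ℝ) : 0 ≤ edgeDist x := le_min zero_le_one (abs_nonneg _)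

lemma edgeDist_le_one (x : ℝ) : edgeDist x ≤ 1 := min_le_left _ _

lemma continuous_edgeDist : Continuous edgeDist := by
  unfold edgeDist
  fun_prop

lemma integrable_abs_mul_edgeDist {f : ℝ → ℝ} (hf : Integrable f) :
    Integrable (fun x => |f x| * edgeDist x) := by
  refine hf.abs.mul_bdd (c := 1) continuous_edgeDist.aestronglyMeasurable (ae_of_all _ fun x => ?_)
  rw [norm_of_nonneg (edgeDist_nonneg x)]
  exact edgeDist_le_one x

/-- A bathtub argument: with r = δ/8, mass at most 4r = δ/2 lies within r of ±1, so at least δ/2 has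
`edgeDist` ≥ r, giving δ²/16. The bound δ ≤ 8 keeps r below the truncation. -/
lemma sq_integral_abs_le {f : ℝ → ℝ} (hf : Integrable f) (h1 : ∀ x, |f x| ≤ 1)
    (hδ : ∫ x, |f x| ≤ 8) : (∫ x, |f x|) ^ 2 ≤ 16 * ∫ x, |f x| * edgeDist x := by
  set δ := ∫ x, |f x| with hδd
  have hδ0 : 0 ≤ δ := integral_nonneg fun x => abs_nonneg _
  set r := δ / 8 with hr
  have hr0 : 0 ≤ r := by positivity
  have hr1 : r ≤ 1 := by rw [hr]; linarith
  set U := Ioo (1 - r) (1 + r) ∪ Ioo (-1 - r) (-1 + r) with hU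
  have hUm : MeasurableSet U := measurableSet_Ioo.union measurableSet_Ioo
  have hUv : volume.real U ≤ 4 * r := by
    refine (measureReal_union_le _ _).trans ?_
    rw [Real.volume_real_Ioo_of_le (by linarith), Real.volume_real_Ioo_of_le (by linarith)]
    linarith
  have hUf : volume U ≠ ⊤ := by
    refine ((measure_union_le _ _).trans_lt ?_).ne
    simp
  have hpt : ∀ x, r * |f x| - r * U.indicator 1 x ≤ |f x| * edgeDist x := by
    intro x
    have hf0 := abs_nonneg (f x)
    by_cases hx : x ∈ U
    · rw [indicator_of_mem hx, Pi.one_apply]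
      have := mul_nonneg hf0 (edgeDist_nonneg x)
      nlinarith [h1 x]
    · rw [indicator_of_notMem hx, mul_zero, sub_zero, mul_comm]
      refine mul_le_mul_of_nonneg_left (le_min hr1 ?_) hf0
      by_contra! hc
      rw [abs_lt] at hc
      apply hx
      rcases le_total 0 x with h | h
      · rw [abs_of_nonneg h] at hc
        exact Or.inl ⟨by linarith, by linarith⟩
      · rw [abs_of_nonpos h] at hc
        exact Or.inr ⟨by linarith, by linarith⟩
  have hUi : Integrable (U.indicator (1 : ℝ → ℝ)) :=
    (integrable_indicator_iff hUm).2 (integrableOn_const hUf)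
  have h2 : ∫ x, (r * |f x| - r * U.indicator 1 x) ≤ _ := integral_mono ((hf.abs.const_mul r).sub (hUi.const_mul r))
    (integrable_abs_mul_edgeDist hf) hpt
  rw [integral_sub (hf.abs.const_mul r) (hUi.const_mul r), integral_const_mul, integral_const_mul,
    integral_indicator_one hUm, ← hδd] at h2
  nlinarith

lemma norm_fourier_le {f : ℝ → ℝ} (ξ : ℝ) :
    ‖𝓕 (fun x => (f x : ℂ)) ξ‖ ≤ ∫ x, |f x| := by
  refine (VectorFourier.norm_fourierIntegral_le_integral_norm _ _ _ _ _).trans (le_of_eq ?_)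
  simp

lemma norm_cexp_sub_cexp_le (a b : ℝ) :
    ‖Complex.exp (a * Complex.I) - Complex.exp (b * Complex.I)‖ ≤ min 2 |a - b| := by
  refine le_min ?_ ?_
  · refine (norm_sub_le _ _).trans ?_
    rw [Complex.norm_exp_ofReal_mul_I, Complex.norm_exp_ofReal_mul_I]
    norm_num
  · have e : Complex.exp (a * Complex.I) - Complex.exp (b * Complex.I) =
        Complex.exp (b * Complex.I) * (Complex.exp (Complex.I * ((a - b : ℝ) : ℂ)) - 1) := by
      rw [mul_sub, ← Complex.exp_add, mul_one]
      congr 2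
      push_cast
      ring
    rw [e, norm_mul, Complex.norm_exp_ofReal_mul_I, one_mul]
    exact norm_exp_I_mul_ofReal_sub_one_le

/-- Vanishing of both half-line integrals allows the phase at x to be reduced by the phase at the
endpoint ±1 on the same side; the difference of phases is controlled by the distance to that
endpoint. -/
lemma norm_fourier_le_edgeDist {f : ℝ → ℝ} (hf : Integrable f) (hp : ∫ x in Ioi 0, f x = 0)
    (hn : ∫ x in Iic 0, f x = 0) (ξ : ℝ) :
    ‖𝓕 (fun x => (f x : ℂ)) ξ‖ ≤ 2 * π * (1 + |ξ|) * ∫ x, |f x| * edgeDist x := by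
  set σ : ℝ → ℝ := fun x => if 0 < x then 1 else -1 with hσ
  have hσm : Measurable σ := Measurable.ite measurableSet_Ioi measurable_const measurable_const
  have hfc : Integrable (fun x => (f x : ℂ)) := hf.ofReal
  have hi1 : Integrable (fun x => Complex.exp (((-2 * π * x * ξ : ℝ) : ℂ) * Complex.I) • (f x : ℂ)) :=
    integrable_cexp_smul hf (by fun_prop)
  have hi2 : Integrable
      (fun x => Complex.exp (((-2 * π * σ x * ξ : ℝ) : ℂ) * Complex.I) • (f x : ℂ)) := by
    refine hfc.bdd_mul (c := 1) ?_ (ae_of_all _ fun x => (Complex.norm_exp_ofReal_mul_I _).le)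
    exact Measurable.aestronglyMeasurable (by fun_prop)
  have hz : ∫ x, Complex.exp (((-2 * π * σ x * ξ : ℝ) : ℂ) * Complex.I) • (f x : ℂ) = 0 := by
    have hIic : ∫ x in Iic 0, Complex.exp (((-2 * π * σ x * ξ : ℝ) : ℂ) * Complex.I) • (f x : ℂ) =
        ∫ x in Iic 0, Complex.exp (((-2 * π * (-1) * ξ : ℝ) : ℂ) * Complex.I) • (f x : ℂ) := by
      refine setIntegral_congr_fun measurableSet_Iic fun x hx => ?_
      have : σ x = -1 := if_neg (not_lt.2 hx)
      simp only [this]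
    have hIoi : ∫ x in Ioi 0, Complex.exp (((-2 * π * σ x * ξ : ℝ) : ℂ) * Complex.I) • (f x : ℂ) =
        ∫ x in Ioi 0, Complex.exp (((-2 * π * 1 * ξ : ℝ) : ℂ) * Complex.I) • (f x : ℂ) := by
      refine setIntegral_congr_fun measurableSet_Ioi fun x hx => ?_
      have : σ x = 1 := if_pos hx
      simp only [this]
    rw [← intervalIntegral.integral_Iic_add_Ioi (b := 0) hi2.integrableOn hi2.integrableOn, hIic,
      hIoi, integral_smul, integral_smul, integral_complex_ofReal, integral_complex_ofReal, hp, hn]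
    simp
  have he : 𝓕 (fun x => (f x : ℂ)) ξ =
      ∫ x, (Complex.exp (((-2 * π * x * ξ : ℝ) : ℂ) * Complex.I) -
        Complex.exp (((-2 * π * σ x * ξ : ℝ) : ℂ) * Complex.I)) • (f x : ℂ) := by
    rw [fourier_real_eq_integral_exp_smul]
    simp only [sub_smul]
    rw [integral_sub hi1 hi2, hz, sub_zero]
  rw [he, ← integral_const_mul]
  refine norm_integral_le_of_norm_le ((integrable_abs_mul_edgeDist hf).const_mul _)
    (ae_of_all _ fun x => ?_)
  rw [norm_smul, Complex.norm_real, norm_eq_abs, mul_comm (|f x|), ← mul_assoc]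
  refine mul_le_mul_of_nonneg_right ((norm_cexp_sub_cexp_le _ _).trans ?_) (abs_nonneg _)
  have hpi := pi_gt_three
  have hξ := abs_nonneg ξ
  have h1 : abs (-2 * π * x * ξ - -2 * π * σ x * ξ) = 2 * π * |ξ| * abs (|x| - 1) := by
    rw [show -2 * π * x * ξ - -2 * π * σ x * ξ = (2 * π * ξ) * (σ x - x) by ring, abs_mul, abs_mul,
      abs_of_pos (show 0 < 2 * π by positivity)]
    congr 1
    by_cases hx : 0 < x
    · have : σ x = 1 := if_pos hx
      rw [this, abs_of_pos hx, abs_sub_comm]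
    · have : σ x = -1 := if_neg hx
      rw [this, abs_of_nonpos (not_lt.1 hx)]
      congr 1
      ring
  rw [h1, edgeDist]
  rcases min_choice (1 : ℝ) (abs (|x| - 1)) with h | h <;> rw [h]
  · refine (min_le_left _ _).trans ?_
    nlinarith
  · refine (min_le_right _ _).trans ?_
    have := abs_nonneg (|x| - 1)
    gcongr
    linarith

/-! ### First variation and the local estimate for perturbations. -/

lemma continuous_K {q : ℝ} (hq : 3 < q) : Continuous (K q) := by
  have h : K q = fun x => (2 * 2 ^ (q - 2) * (2 * π)⁻¹) * sincPowCos (q - 2) x :=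
    funext fun x => K_eq_sincPowCos (by linarith) x
  have h2 : Continuous (sincPowCos (q - 2)) := continuous_iff_continuousAt.2 fun x =>
    (hasDerivAt_sincPowCos (by linarith) x).continuousAt
  rw [h]
  fun_prop

lemma abs_K_le {q : ℝ} (hq : 2 < q) (x : ℝ) : |K q x| ≤ ∫ ξ, |weight q ξ| := by
  rw [K_eq_integral hq, ← norm_eq_abs]
  refine norm_integral_le_of_norm_le (integrable_weight hq).abs (ae_of_all _ fun ξ => ?_)
  rw [norm_mul, norm_eq_abs, norm_eq_abs]
  exact mul_le_of_le_one_right (abs_nonneg _) (abs_cos_le_one _)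

lemma integral_weight_mul_re_fourier {q : ℝ} (hq : 2 < q) {f : ℝ → ℝ} (hf : Integrable f) :
    ∫ ξ, weight q ξ * (𝓕 (fun x => (f x : ℂ)) ξ).re = ∫ x, K q x * f x := by
  have hw := integrable_weight hq
  have hint : Integrable (fun z : ℝ × ℝ => weight q z.1 * f z.2 * cos (2 * π * z.2 * z.1))
      (volume.prod volume) := by
    refine (hw.mul_prod hf).mul_bdd (c := 1) ?_ (ae_of_all _ fun z => abs_cos_le_one _)
    exact Continuous.aestronglyMeasurable (by fun_prop)
  have h := integral_integral_swap (f := fun ξ x => weight q ξ * f x * cos (2 * π * x * ξ)) hint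
  have h1 : ∀ ξ, ∫ x, weight q ξ * f x * cos (2 * π * x * ξ) =
      weight q ξ * (𝓕 (fun x => (f x : ℂ)) ξ).re := by
    intro ξ
    rw [re_fourier_ofReal hf, ← integral_const_mul]
    simp only [mul_assoc]
  have h2 : ∀ x, ∫ ξ, weight q ξ * f x * cos (2 * π * x * ξ) = K q x * f x := by
    intro x
    rw [K_eq_integral hq, ← integral_mul_const]
    congr 1
    ext ξ
    ring
  simp only [h1, h2] at h
  exact h

/-- Subtracting the constant `K q 1` is free because ∫ f = 0; the inequality then holds pointwise by
`exists_K_gap` and the sign pattern of f. -/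
lemma exists_integral_K_mul_le {q : ℝ} (hq : 3 < q) :
    ∃ κ > 0, ∀ f : ℝ → ℝ, Integrable f → (∀ x, |x| ≤ 1 → f x ≤ 0) → (∀ x, 1 < |x| → 0 ≤ f x) →
      ∫ x, f x = 0 → ∫ x, K q x * f x ≤ -κ * ∫ x, |f x| * edgeDist x := by
  obtain ⟨κ, hκ, hgap⟩ := exists_K_gap hq
  refine ⟨κ, hκ, fun f hf hin hout h0 => ?_⟩
  have hKf : Integrable (fun x => K q x * f x) :=
    hf.bdd_mul (continuous_K hq).aestronglyMeasurable
      (ae_of_all _ fun x => abs_K_le (by linarith) x)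
  have h1 : ∫ x, K q x * f x = ∫ x, (K q x * f x - K q 1 * f x) := by
    rw [integral_sub hKf (hf.const_mul _), integral_const_mul, h0, mul_zero, sub_zero]
  rw [h1, ← integral_const_mul]
  refine integral_mono (hKf.sub (hf.const_mul _))
    ((integrable_abs_mul_edgeDist hf).const_mul _) fun x => ?_
  obtain ⟨ha, hb⟩ := hgap x
  simp only [← edgeDist.eq_1] at ha hb
  rcases le_or_gt |x| 1 with hx | hx
  · have h2 := hin x hx
    have h3 := ha hx
    simp only [abs_of_nonpos h2]
    nlinarith
  · have h2 := hout x hx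
    have h3 := hb hx.le
    simp only [abs_of_nonneg h2]
    nlinarith

lemma rpow_interpolation_le {δ m θ : ℝ} (hδ : 0 ≤ δ) (hm : 0 ≤ m) (hθ0 : 0 < θ) (hθ1 : θ ≤ 1)
    (h : δ ^ 2 ≤ 16 * m) : δ ^ (2 - θ) * m ^ θ ≤ 16 * δ ^ θ * m := by
  have h1 : δ ^ (2 - θ) = δ ^ θ * (δ ^ 2) ^ (1 - θ) := by
    rw [← rpow_natCast δ 2, ← rpow_mul hδ,
      ← rpow_add_of_nonneg hδ hθ0.le (by push_cast; nlinarith)]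
    congr 1
    push_cast
    ring
  have h2 : (δ ^ 2) ^ (1 - θ) ≤ 16 * m ^ (1 - θ) := by
    refine (rpow_le_rpow (by positivity) h (by linarith)).trans ?_
    rw [mul_rpow (by norm_num) hm]
    refine mul_le_mul_of_nonneg_right ?_ (by positivity)
    exact rpow_le_self_of_one_le (by norm_num) (by linarith)
  have h3 : m ^ (1 - θ) * m ^ θ = m := by
    rw [← rpow_add_of_nonneg hm (by linarith) hθ0.le, sub_add_cancel, rpow_one]
  calc δ ^ (2 - θ) * m ^ θ = δ ^ θ * (δ ^ 2) ^ (1 - θ) * m ^ θ := by rw [h1]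
    _ ≤ δ ^ θ * (16 * m ^ (1 - θ)) * m ^ θ := by gcongr
    _ = 16 * δ ^ θ * (m ^ (1 - θ) * m ^ θ) := by ring
    _ = _ := by rw [h3]

lemma integrable_ballHat_rpow_mul {r θ : ℝ} (hr : 0 ≤ r) (hθ : 0 ≤ θ) (h : 1 < r - θ) :
    Integrable (fun ξ : ℝ => |2 * sinc (2 * π * ξ)| ^ r * (1 + |ξ|) ^ θ) := by
  have h1 := ((integrable_one_add_abs_rpow_mul_abs_sinc_rpow hr h).comp_mul_left'
    (R := 2 * π) (by positivity)).const_mul (2 ^ r)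
  refine h1.mono' (by
    have := continuous_sinc.measurable
    fun_prop) (ae_of_all _ fun ξ => ?_)
  rw [norm_of_nonneg (by positivity), abs_mul, mul_rpow (abs_nonneg _) (abs_nonneg _), abs_two]
  have h2 : (1 + |ξ|) ^ θ ≤ (1 + |2 * π * ξ|) ^ θ := by
    refine rpow_le_rpow (by positivity) ?_ hθ
    rw [abs_mul, abs_of_pos (show 0 < 2 * π by positivity)]
    nlinarith [abs_nonneg ξ, pi_gt_three]
  calc _ ≤ 2 ^ r * |sinc (2 * π * ξ)| ^ r * (1 + |2 * π * ξ|) ^ θ := by gcongr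
    _ = _ := by ring

lemma exists_integral_norm_add_fourier_rpow_le {q : ℝ} (hq : 3 < q) :
    ∃ c > 0, ∃ δ₀ > 0, ∀ f : ℝ → ℝ, Integrable f → (∀ x, |f x| ≤ 1) →
      (∀ x, |x| ≤ 1 → f x ≤ 0) → (∀ x, 1 < |x| → 0 ≤ f x) →
      ∫ x in Ioi 0, f x = 0 → ∫ x in Iic 0, f x = 0 → ∫ x, |f x| ≤ δ₀ →
      ∫ ξ, ‖((2 * sinc (2 * π * ξ) : ℝ) : ℂ) + 𝓕 (fun x => (f x : ℂ)) ξ‖ ^ q ≤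
        (∫ ξ, |2 * sinc (2 * π * ξ)| ^ q) - c * (∫ x, |f x|) ^ 2 := by
  obtain ⟨κ, hκ, hK⟩ := exists_integral_K_mul_le hq
  -- The last condition makes |B̂|^{q-2}(1 + |ξ|)^θ integrable; θ ≤ q - 3 gives δ^{q-3} ≤ δ^θ in the
  -- pure power term.
  obtain ⟨θ, hθ0, hθ1, hθq, hθq'⟩ : ∃ θ : ℝ, 0 < θ ∧ θ ≤ 1 ∧ θ ≤ q - 3 ∧ 1 < q - 2 - θ := by
    refine ⟨min 1 ((q - 3) / 2), lt_min one_pos (by linarith), min_le_left _ _, ?_, ?_⟩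
    · linarith [min_le_right 1 ((q - 3) / 2)]
    · linarith [min_le_right 1 ((q - 3) / 2)]
  set a : ℝ → ℝ := fun ξ => 2 * sinc (2 * π * ξ) with ha
  have hac : Continuous a := by
    have := continuous_sinc
    fun_prop
  have hwθ := integrable_ballHat_rpow_mul (r := q - 2) (by linarith) hθ0.le hθq'
  set C₀ := ∫ ξ : ℝ, |2 * sinc (2 * π * ξ)| ^ (q - 2) * (1 + |ξ|) ^ θ with hC₀
  have hC₀0 : 0 ≤ C₀ := integral_nonneg fun ξ => by positivity
  set C := q / 2 + q * (q - 2) * 2 ^ (q - 2) with hC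
  have hC0 : 0 ≤ C := by
    have : 0 ≤ q - 2 := by linarith
    positivity
  set D := C * (16 * (C₀ * (2 * π) ^ θ + 1)) with hD
  have hD0 : 0 ≤ D := by positivity
  have hy : 0 < q * κ / (2 * (D + 1)) := by positivity
  -- The threshold makes the remainder Dδ^θ m at most half of the gain qκm; the other half exceeds
  -- qκδ²/32 because δ² ≤ 16m.
  refine ⟨q * κ / 32, by positivity, min 1 ((q * κ / (2 * (D + 1))) ^ θ⁻¹), by positivity, ?_⟩
  intro f hf hf1 hin hout hp hn hδ
  set δ := ∫ x, |f x| with hδd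
  set m := ∫ x, |f x| * edgeDist x with hm
  set w : ℝ → ℂ := 𝓕 (fun x => (f x : ℂ)) with hw
  have hδ0 : 0 ≤ δ := integral_nonneg fun x => abs_nonneg _
  have hm0 : 0 ≤ m := integral_nonneg fun x => mul_nonneg (abs_nonneg _) (edgeDist_nonneg x)
  have hδ1 : δ ≤ 1 := hδ.trans (min_le_left _ _)
  have hδm : δ ^ 2 ≤ 16 * m := sq_integral_abs_le hf hf1 (hδ1.trans (by norm_num))
  have hδθ : D * δ ^ θ ≤ q * κ / 2 := by
    have h1 : δ ^ θ ≤ q * κ / (2 * (D + 1)) := by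
      refine (rpow_le_rpow hδ0 (hδ.trans (min_le_right _ _)) hθ0.le).trans (le_of_eq ?_)
      rw [← rpow_mul hy.le, inv_mul_cancel₀ hθ0.ne', rpow_one]
    rw [le_div_iff₀ (by positivity)] at h1
    have := rpow_nonneg hδ0 θ
    nlinarith
  have h0 : ∫ x, f x = 0 := by
    rw [← intervalIntegral.integral_Iic_add_Ioi (b := 0) hf.integrableOn hf.integrableOn, hp, hn,
      add_zero]
  have hfc : Integrable (fun x => (f x : ℂ)) := hf.ofReal
  have hwc : Continuous w := continuous_fourier hfc
  have hw1 : ∀ ξ, ‖w ξ‖ ≤ δ := fun ξ => norm_fourier_le ξ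
  have hw2 : ∀ ξ, ‖w ξ‖ ≤ 2 * π * (1 + |ξ|) * m := fun ξ => norm_fourier_le_edgeDist hf hp hn ξ
  have hf2i : Integrable (fun x => ‖(f x : ℂ)‖ ^ 2) := by
    refine hf.abs.mono' (hfc.1.norm.pow 2) (ae_of_all _ fun x => ?_)
    rw [norm_of_nonneg (by positivity), Complex.norm_real, norm_eq_abs]
    exact pow_le_of_le_one (abs_nonneg _) (hf1 x) two_ne_zero
  obtain ⟨hP1, hP2⟩ := integrable_norm_fourier_sq hfc ((memLp_two_iff_integrable_sq_norm hfc.1).2 hf2i)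
  have hP3 : ∫ ξ, ‖w ξ‖ ^ 2 ≤ δ := by
    rw [hw, hP2]
    refine integral_mono hf2i hf.abs fun x => ?_
    simp only [Complex.norm_real, norm_eq_abs]
    exact pow_le_of_le_one (abs_nonneg _) (hf1 x) two_ne_zero
  have hwq : ∀ ξ, ‖w ξ‖ ^ q ≤ δ ^ (q - 2) * ‖w ξ‖ ^ 2 := by
    intro ξ
    have e : ‖w ξ‖ ^ q = ‖w ξ‖ ^ (q - 2) * ‖w ξ‖ ^ 2 := by
      rw [← rpow_natCast _ 2, ← rpow_add_of_nonneg (norm_nonneg _) (by linarith) (by positivity)]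
      norm_num
    rw [e]
    exact mul_le_mul_of_nonneg_right (rpow_le_rpow (norm_nonneg _) (hw1 ξ) (by linarith))
      (by positivity)
  have i0 : Integrable (fun ξ => |a ξ| ^ q) := by
    simpa only [rpow_zero, mul_one] using integrable_ballHat_rpow_mul (r := q) (θ := 0) (by linarith) le_rfl (by linarith)
  have i1 : Integrable (fun ξ => weight q ξ * (w ξ).re) := by
    refine (integrable_weight (by linarith)).mul_bdd (c := δ)
      (Complex.continuous_re.comp hwc).aestronglyMeasurable (ae_of_all _ fun ξ => ?_)
    exact (Complex.abs_re_le_norm _).trans (hw1 ξ)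
  have i2' : Integrable (fun ξ => |a ξ| ^ (q - 2)) := by
    simpa only [rpow_zero, mul_one] using integrable_ballHat_rpow_mul (r := q - 2) (θ := 0) (by linarith) le_rfl (by linarith)
  have i2 : Integrable (fun ξ => |a ξ| ^ (q - 2) * ‖w ξ‖ ^ 2) := by
    refine i2'.mul_bdd (c := δ ^ 2) (hwc.norm.pow 2).aestronglyMeasurable
      (ae_of_all _ fun ξ => ?_)
    rw [norm_of_nonneg (by positivity)]
    exact pow_le_pow_left₀ (norm_nonneg _) (hw1 ξ) 2
  have i3 : Integrable (fun ξ => ‖w ξ‖ ^ q) := by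
    refine (hP1.const_mul (δ ^ (q - 2))).mono'
      (hwc.norm.rpow_const fun _ => Or.inr (by linarith)).aestronglyMeasurable
      (ae_of_all _ fun ξ => ?_)
    rw [norm_of_nonneg (by positivity)]
    exact hwq ξ
  have hexp : ∫ ξ, ‖(a ξ : ℂ) + w ξ‖ ^ q ≤
      (∫ ξ, |a ξ| ^ q) + q * (∫ ξ, weight q ξ * (w ξ).re) +
        C * ((∫ ξ, |a ξ| ^ (q - 2) * ‖w ξ‖ ^ 2) + ∫ ξ, ‖w ξ‖ ^ q) := by
    have i4 : Integrable (fun ξ => C * (|a ξ| ^ (q - 2) * ‖w ξ‖ ^ 2 + ‖w ξ‖ ^ q)) :=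
      (i2.add i3).const_mul C
    have h1 : ∫ ξ, ‖(a ξ : ℂ) + w ξ‖ ^ q ≤ ∫ ξ, (|a ξ| ^ q + q * (weight q ξ * (w ξ).re) +
        C * (|a ξ| ^ (q - 2) * ‖w ξ‖ ^ 2 + ‖w ξ‖ ^ q)) := by
      refine integral_mono_of_nonneg (ae_of_all _ fun ξ => by positivity)
        ((i0.add (i1.const_mul q)).add i4)
        (ae_of_all _ fun ξ => norm_add_rpow_le hq.le (a ξ) (w ξ))
    refine h1.trans (le_of_eq ?_)
    rw [integral_add (f := fun ξ => |a ξ| ^ q + q * (weight q ξ * (w ξ).re))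
      (i0.add (i1.const_mul q)) i4, integral_add i0 (i1.const_mul q),
      integral_const_mul, integral_const_mul, integral_add i2 i3]
  have s1 : ∫ ξ, weight q ξ * (w ξ).re ≤ -κ * m := by
    rw [integral_weight_mul_re_fourier (by linarith) hf]
    exact hK f hf hin hout h0
  -- Of the two powers of |w|, 2 - θ are bounded by δ and θ by the moment m, at the price of the
  -- weight (1 + |ξ|)^θ.
  have s2 : ∫ ξ, |a ξ| ^ (q - 2) * ‖w ξ‖ ^ 2 ≤ C₀ * (2 * π) ^ θ * (16 * δ ^ θ * m) := by
    have h1 : ∀ ξ, |a ξ| ^ (q - 2) * ‖w ξ‖ ^ 2 ≤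
        |2 * sinc (2 * π * ξ)| ^ (q - 2) * (1 + |ξ|) ^ θ *
          ((2 * π) ^ θ * (δ ^ (2 - θ) * m ^ θ)) := by
      intro ξ
      have e : ‖w ξ‖ ^ 2 = ‖w ξ‖ ^ (2 - θ) * ‖w ξ‖ ^ θ := by
        rw [← rpow_natCast _ 2, ← rpow_add_of_nonneg (norm_nonneg _) (by linarith) hθ0.le]
        norm_num
      have h2 : ‖w ξ‖ ^ (2 - θ) ≤ δ ^ (2 - θ) :=
        rpow_le_rpow (norm_nonneg _) (hw1 ξ) (by linarith)
      have h3 : ‖w ξ‖ ^ θ ≤ (2 * π) ^ θ * (1 + |ξ|) ^ θ * m ^ θ := by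
        refine (rpow_le_rpow (norm_nonneg _) (hw2 ξ) hθ0.le).trans (le_of_eq ?_)
        rw [mul_rpow (by positivity) hm0, mul_rpow (by positivity) (by positivity)]
      rw [e]
      calc |a ξ| ^ (q - 2) * (‖w ξ‖ ^ (2 - θ) * ‖w ξ‖ ^ θ) ≤
          |a ξ| ^ (q - 2) * (δ ^ (2 - θ) * ((2 * π) ^ θ * (1 + |ξ|) ^ θ * m ^ θ)) := by gcongr
        _ = _ := by ring
    have h4 := integral_mono i2 (hwθ.mul_const _) h1
    rw [integral_mul_const, ← hC₀] at h4
    refine h4.trans ?_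
    rw [← mul_assoc]
    exact mul_le_mul_of_nonneg_left (rpow_interpolation_le hδ0 hm0 hθ0 hθ1 hδm) (by positivity)
  -- The uniform bound on q - 2 factors and Plancherel on the other two give δ^{q-1} = δ^{q-3} δ².
  have s3 : ∫ ξ, ‖w ξ‖ ^ q ≤ 16 * δ ^ θ * m := by
    have h1 := integral_mono i3 (hP1.const_mul (δ ^ (q - 2))) hwq
    rw [integral_const_mul] at h1
    have e : δ ^ (q - 2) = δ ^ (q - 3) * δ := by
      rw [← rpow_add_one' hδ0 (by linarith)]
      congr 1
      ring
    have h2 : δ ^ (q - 3) ≤ δ ^ θ :=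
      rpow_le_rpow_of_exponent_ge' hδ0 hδ1 hθ0.le hθq
    calc ∫ ξ, ‖w ξ‖ ^ q ≤ δ ^ (q - 2) * ∫ ξ, ‖w ξ‖ ^ 2 := h1
      _ ≤ δ ^ (q - 2) * δ := by gcongr
      _ = δ ^ (q - 3) * δ ^ 2 := by rw [e]; ring
      _ ≤ δ ^ θ * (16 * m) := by gcongr
      _ = _ := by ring
  have hfin : C * ((∫ ξ, |a ξ| ^ (q - 2) * ‖w ξ‖ ^ 2) + ∫ ξ, ‖w ξ‖ ^ q) ≤ q * κ / 2 * m := by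
    calc _ ≤ C * (C₀ * (2 * π) ^ θ * (16 * δ ^ θ * m) + 16 * δ ^ θ * m) := by gcongr
      _ = D * δ ^ θ * m := by rw [hD]; ring
      _ ≤ _ := by gcongr
  have hs1 : q * (∫ ξ, weight q ξ * (w ξ).re) ≤ q * (-κ * m) := by gcongr
  have hlast : q * κ / 32 * δ ^ 2 ≤ q * κ / 32 * (16 * m) := by gcongr
  linarith

/-! ### The local estimate for sets of measure 2 with median 0. -/

lemma fourier_add_of_integrable {f g : ℝ → ℂ} (hf : Integrable f) (hg : Integrable g) (ξ : ℝ) :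
    𝓕 (fun x => f x + g x) ξ = 𝓕 f ξ + 𝓕 g ξ := by
  have h := VectorFourier.fourierIntegral_add (L := innerₗ ℝ) (μ := (volume : Measure ℝ))
    continuous_fourierChar (by exact continuous_inner) hf hg
  exact congrFun h ξ

/-- The difference of the indicator functions of `E` and of the unit ball. -/
noncomputable def excess (E : Set ℝ) (x : ℝ) : ℝ := E.indicator 1 x - unitBall.indicator 1 x

lemma measurableSet_unitBall : MeasurableSet unitBall := by
  rw [unitBall_eq_Icc]
  exact measurableSet_Icc

lemma volume_unitBall : volume unitBall = 2 := by
  rw [unitBall_eq_Icc, Real.volume_Icc]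
  norm_num

lemma integrable_indicator_one {E : Set ℝ} (hE : MeasurableSet E) (h : volume E ≠ ⊤) :
    Integrable (E.indicator (1 : ℝ → ℝ)) :=
  (integrable_indicator_iff hE).2 (integrableOn_const h)

lemma abs_excess (E : Set ℝ) (x : ℝ) : |excess E x| = (unitBall ∆ E).indicator 1 x := by
  by_cases h1 : x ∈ E <;> by_cases h2 : x ∈ unitBall <;>
    simp [excess, h1, h2, mem_symmDiff, indicator]

lemma indicatorHat_eq_add_excess {E : Set ℝ} (hE : MeasurableSet E) (h : volume E ≠ ⊤) (ξ : ℝ) :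
    indicatorHat E ξ = indicatorHat unitBall ξ + 𝓕 (fun x => (excess E x : ℂ)) ξ := by
  have hB : Integrable (unitBall.indicator (1 : ℝ → ℝ)) :=
    integrable_indicator_one measurableSet_unitBall (by simp [volume_unitBall])
  have hx : Integrable (excess E) := (integrable_indicator_one hE h).sub hB
  have e : ∀ S : Set ℝ, S.indicator (fun _ : ℝ => (1 : ℂ)) =
      fun x => ((S.indicator (1 : ℝ → ℝ) x : ℝ) : ℂ) := by
    intro S
    ext x
    by_cases hxS : x ∈ S <;> simp [hxS]
  rw [indicatorHat, indicatorHat, e, e,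
    ← fourier_add_of_integrable (f := fun x => ((unitBall.indicator (1 : ℝ → ℝ) x : ℝ) : ℂ))
      (g := fun x => (excess E x : ℂ)) hB.ofReal hx.ofReal]
  refine congrArg (fun F : ℝ → ℂ => 𝓕 F ξ) ?_
  ext x
  rw [excess]
  push_cast
  ring

lemma exists_integral_norm_indicatorHat_rpow_le {q : ℝ} (hq : 3 < q) :
    ∃ c > 0, ∃ δ₀ > 0, ∀ E : Set ℝ, MeasurableSet E → volume E = 2 →
      volume (E ∩ Ioi 0) = 1 → volume.real (unitBall ∆ E) ≤ δ₀ →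
      ∫ ξ, ‖indicatorHat E ξ‖ ^ q ≤
        (∫ ξ, ‖indicatorHat unitBall ξ‖ ^ q) - c * volume.real (unitBall ∆ E) ^ 2 := by
  obtain ⟨c, hc, δ₀, hδ₀, h⟩ := exists_integral_norm_add_fourier_rpow_le hq
  refine ⟨c, hc, δ₀, hδ₀, fun E hE hE2 hE1 hEδ => ?_⟩
  have hEf : volume E ≠ ⊤ := by simp [hE2]
  have hiE := integrable_indicator_one hE hEf
  have hiB := integrable_indicator_one measurableSet_unitBall (by simp [volume_unitBall])
  have hδ : ∫ x, |excess E x| = volume.real (unitBall ∆ E) := by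
    simp only [abs_excess]
    exact integral_indicator_one (measurableSet_unitBall.symmDiff hE)
  have htot : ∫ x, excess E x = 0 := by
    simp only [excess]
    rw [integral_sub hiE hiB, integral_indicator_one hE, integral_indicator_one
      measurableSet_unitBall, measureReal_def, measureReal_def, hE2, volume_unitBall, sub_self]
  have hpos : ∫ x in Ioi 0, excess E x = 0 := by
    simp only [excess]
    rw [integral_sub hiE.integrableOn hiB.integrableOn, integral_indicator_one hE,
      integral_indicator_one measurableSet_unitBall, measureReal_restrict_apply hE,
      measureReal_restrict_apply measurableSet_unitBall, measureReal_def, hE1]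
    have : unitBall ∩ Ioi 0 = Ioc 0 1 := by
      rw [unitBall_eq_Icc]
      ext x
      simp only [mem_inter_iff, mem_Icc, mem_Ioi, mem_Ioc]
      constructor <;> intro hx
      · exact ⟨hx.2, hx.1.2⟩
      · exact ⟨⟨by linarith [hx.1], hx.2⟩, hx.1⟩
    rw [this, Real.volume_real_Ioc_of_le zero_le_one]
    simp
  have hneg : ∫ x in Iic 0, excess E x = 0 := by
    have := intervalIntegral.integral_Iic_add_Ioi (b := 0) (hiE.sub hiB).integrableOn
      (hiE.sub hiB).integrableOn
    change (∫ x in Iic 0, excess E x) + (∫ x in Ioi 0, excess E x) = ∫ x, excess E x at this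
    linarith
  have key := h (excess E) (hiE.sub hiB) (fun x => ?_) (fun x hx => ?_) (fun x hx => ?_) hpos hneg
    (by rw [hδ]; exact hEδ)
  · rw [hδ] at key
    simp only [indicatorHat_eq_add_excess hE hEf]
    simp only [indicatorHat_unitBall, Complex.norm_real, norm_eq_abs]
    exact key
  · rw [abs_excess]
    exact indicator_le_self' (fun _ _ => zero_le_one) x
  · have hxB : x ∈ unitBall := hx
    rw [excess, indicator_of_mem hxB, Pi.one_apply, sub_nonpos]
    exact indicator_le_self' (fun _ _ => zero_le_one) x
  · have hxB : x ∉ unitBall := not_le.2 hx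
    rw [excess, indicator_of_notMem hxB, sub_zero]
    exact indicator_nonneg (fun _ _ => zero_le_one) x

/-! ### Affine invariance of `Phi`. -/

lemma continuous_indicatorHat {E : Set ℝ} (hE : MeasurableSet E) (h : volume E ≠ ⊤) :
    Continuous (indicatorHat E) :=
  continuous_fourier ((integrable_indicator_iff hE).2 (integrableOn_const h))

lemma Phi_eq {q : ℝ} (hq : 1 < q) {E : Set ℝ} (hE : MeasurableSet E) (h : volume E ≠ ⊤) :
    Phi q E = volume.real E ^ (-((q - 1) / q)) * (∫ ξ, ‖indicatorHat E ξ‖ ^ q) ^ q⁻¹ := by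
  have hq0 : 0 < q := by linarith
  have hm := (continuous_indicatorHat hE h).aestronglyMeasurable (μ := volume)
  rw [Phi, one_div_div, toReal_eLpNorm hm,
    lpNorm_eq_integral_norm_rpow_toReal (by simpa using hq0) ENNReal.ofReal_ne_top hm,
    ENNReal.toReal_ofReal hq0.le, measureReal_def]

/-- The preimage of `E` under the affine map `y ↦ c + r * y`. -/
def rescale (c r : ℝ) (E : Set ℝ) : Set ℝ := (fun y => r * y) ⁻¹' ((fun x => c + x) ⁻¹' E)

lemma mem_rescale {c r : ℝ} {E : Set ℝ} {y : ℝ} : y ∈ rescale c r E ↔ c + r * y ∈ E := Iff.rfl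

lemma measurableSet_rescale {c r : ℝ} {E : Set ℝ} (hE : MeasurableSet E) :
    MeasurableSet (rescale c r E) :=
  (measurable_const_mul r) ((measurable_const_add c) hE)

lemma volume_rescale {c r : ℝ} (hr : 0 < r) (E : Set ℝ) :
    volume (rescale c r E) = ENNReal.ofReal r⁻¹ * volume E := by
  rw [rescale, Real.volume_preimage_mul_left hr.ne', measure_preimage_add,
    abs_of_pos (inv_pos.2 hr)]

lemma volume_real_rescale {c r : ℝ} (hr : 0 < r) (E : Set ℝ) :
    volume.real (rescale c r E) = r⁻¹ * volume.real E := by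
  rw [measureReal_def, volume_rescale hr, ENNReal.toReal_mul,
    ENNReal.toReal_ofReal (inv_pos.2 hr).le, measureReal_def]

lemma norm_indicatorHat_rescale {c r : ℝ} (hr : 0 < r) (E : Set ℝ) (ξ : ℝ) :
    ‖indicatorHat (rescale c r E) ξ‖ = r⁻¹ * ‖indicatorHat E (r⁻¹ * ξ)‖ := by
  let G : ℝ → ℂ := fun x => Complex.exp (((2 * π * c * (r⁻¹ * ξ) : ℝ) : ℂ) * Complex.I) *
    (Complex.exp (((-2 * π * x * (r⁻¹ * ξ) : ℝ) : ℂ) * Complex.I) •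
      E.indicator (fun _ : ℝ => (1 : ℂ)) x)
  have h1 : indicatorHat (rescale c r E) ξ = ∫ y, G (c + r * y) := by
    rw [indicatorHat, fourier_real_eq_integral_exp_smul]
    congr 1
    ext y
    simp only [G]
    by_cases hy : c + r * y ∈ E
    · have hy' : y ∈ rescale c r E := hy
      simp only [indicator_of_mem hy, indicator_of_mem hy', smul_eq_mul, mul_one]
      rw [← Complex.exp_add, ← add_mul, ← Complex.ofReal_add]
      congr 3
      field_simp
      ring
    · have hy' : y ∉ rescale c r E := hy
      simp [indicator_of_notMem hy, indicator_of_notMem hy']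
  have h2 : ∀ g : ℝ → ℂ, ∫ y, g (c + r * y) = r⁻¹ • ∫ x, g x := by
    intro g
    rw [Measure.integral_comp_mul_left (fun x => g (c + x)), integral_add_left_eq_self,
      abs_of_pos (inv_pos.2 hr)]
  rw [h1, h2]
  simp only [G]
  rw [integral_const_mul, ← fourier_real_eq_integral_exp_smul, norm_smul, norm_mul,
    Complex.norm_exp_ofReal_mul_I, one_mul, norm_of_nonneg (inv_pos.2 hr).le]
  rfl

lemma Phi_rescale {q : ℝ} (hq : 1 < q) {c r : ℝ} (hr : 0 < r) {E : Set ℝ} (hE : MeasurableSet E)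
    (h : volume E ≠ ⊤) : Phi q (rescale c r E) = Phi q E := by
  have hq0 : 0 < q := by linarith
  have h' : volume (rescale c r E) ≠ ⊤ := by
    rw [volume_rescale hr]
    exact ENNReal.mul_ne_top ENNReal.ofReal_ne_top h
  rw [Phi_eq hq hE h, Phi_eq hq (measurableSet_rescale hE) h', volume_real_rescale hr]
  have hri : 0 < r⁻¹ := inv_pos.2 hr
  have h1 : ∫ ξ, ‖indicatorHat (rescale c r E) ξ‖ ^ q =
      r⁻¹ ^ (q - 1) * ∫ ξ, ‖indicatorHat E ξ‖ ^ q := by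
    have e : ∀ ξ, ‖indicatorHat (rescale c r E) ξ‖ ^ q =
        r⁻¹ ^ q * (fun ζ => ‖indicatorHat E ζ‖ ^ q) (r⁻¹ * ξ) := by
      intro ξ
      rw [norm_indicatorHat_rescale hr, mul_rpow hri.le (norm_nonneg _)]
    simp only [e]
    rw [integral_const_mul, Measure.integral_comp_mul_left (fun ζ => ‖indicatorHat E ζ‖ ^ q),
      inv_inv, abs_of_pos hr, smul_eq_mul, ← mul_assoc, rpow_sub_one hri.ne', div_inv_eq_mul]
  have hI : 0 ≤ ∫ ξ, ‖indicatorHat E ξ‖ ^ q := integral_nonneg fun ξ => by positivity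
  have h2 : r⁻¹ ^ (-((q - 1) / q)) * (r⁻¹ ^ (q - 1)) ^ q⁻¹ = 1 := by
    rw [← rpow_mul hri.le, ← rpow_add hri, ← div_eq_mul_inv, neg_add_cancel, rpow_zero]
  rw [h1, mul_rpow hri.le measureReal_nonneg, mul_rpow (by positivity) hI]
  calc _ = (r⁻¹ ^ (-((q - 1) / q)) * (r⁻¹ ^ (q - 1)) ^ q⁻¹) *
        (volume.real E ^ (-((q - 1) / q)) * (∫ ξ, ‖indicatorHat E ξ‖ ^ q) ^ q⁻¹) := by ring
    _ = _ := by rw [h2, one_mul]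

lemma unitBall_symmDiff_rescale {c r : ℝ} (hr : 0 < r) (E : Set ℝ) :
    unitBall ∆ rescale c r E = rescale c r (Icc (c - r) (c + r) ∆ E) := by
  have h : ∀ y : ℝ, y ∈ unitBall ↔ c + r * y ∈ Icc (c - r) (c + r) := by
    intro y
    rw [unitBall_eq_Icc, mem_Icc, mem_Icc]
    constructor <;> rintro ⟨h1, h2⟩ <;> constructor <;> nlinarith
  ext y
  simp only [mem_symmDiff, mem_rescale, h]

/-! ### Distance to intervals and normalisation by the median. -/

lemma Phi_congr {q : ℝ} {E F : Set ℝ} (h : E =ᵐ[volume] F) : Phi q E = Phi q F := by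
  have h1 : indicatorHat E = indicatorHat F := by
    ext ξ
    exact fourier_congr_ae (indicator_ae_eq_of_ae_eq_set h) ξ
  rw [Phi, Phi, h1, measure_congr h]

lemma distEllipsoids_congr {E F : Set ℝ} (h : E =ᵐ[volume] F) :
    distEllipsoids E = distEllipsoids F := by
  have h1 : ∀ S : Set ℝ, volume (S ∆ E) = volume (S ∆ F) := fun S =>
    measure_congr (ae_eq_set_symmDiff (EventuallyEq.refl _ S) h)
  simp only [distEllipsoids, h1, measure_congr h]

lemma distEllipsoids_nonneg (E : Set ℝ) : 0 ≤ distEllipsoids E := by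
  refine Real.sInf_nonneg ?_
  rintro _ ⟨S, -, -, rfl⟩
  positivity

lemma distEllipsoids_le {E : Set ℝ} (h : volume E ≠ ⊤) {c r : ℝ} (hr : 0 < r)
    (hE : volume.real E = 2 * r) :
    distEllipsoids E ≤ volume.real (unitBall ∆ rescale c r E) / 2 := by
  refine csInf_le ⟨0, ?_⟩ ⟨Icc (c - r) (c + r), (isEllipsoid_iff _).2
    ⟨c - r, c + r, by linarith, rfl⟩, ?_, ?_⟩
  · rintro _ ⟨S, -, -, rfl⟩
    positivity
  · rw [Real.volume_Icc, ← ENNReal.ofReal_toReal h, ← measureReal_def, hE]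
    congr 1
    ring
  · rw [unitBall_symmDiff_rescale hr, volume_real_rescale hr, ← measureReal_def, ← measureReal_def,
      hE]
    field_simp

lemma exists_Icc_of_distEllipsoids_lt {E : Set ℝ} (h0 : 0 < volume E) (h : volume E ≠ ⊤) {η : ℝ}
    (hη : distEllipsoids E < η) :
    ∃ c r : ℝ, 0 < r ∧ volume.real E = 2 * r ∧
      volume.real (Icc (c - r) (c + r) ∆ E) < η * (2 * r) := by
  have hE0 : 0 < volume.real E := ENNReal.toReal_pos h0.ne' h
  have hne : {x : ℝ | ∃ S : Set ℝ, IsEllipsoid S ∧ volume S = volume E ∧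
      x = (volume (S ∆ E)).toReal / (volume E).toReal}.Nonempty := by
    refine ⟨_, Icc 0 (volume.real E), (isEllipsoid_iff _).2 ⟨0, _, hE0, rfl⟩, ?_, rfl⟩
    rw [Real.volume_Icc, sub_zero, measureReal_def, ENNReal.ofReal_toReal h]
  obtain ⟨_, ⟨S, hS, hSE, rfl⟩, hlt⟩ := exists_lt_of_csInf_lt hne hη
  obtain ⟨a, b, hab, rfl⟩ := (isEllipsoid_iff _).1 hS
  have hr : volume.real E = b - a := by
    rw [measureReal_def, ← hSE, Real.volume_Icc, ENNReal.toReal_ofReal (by linarith)]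
  refine ⟨(a + b) / 2, (b - a) / 2, by linarith, by linarith, ?_⟩
  rw [← measureReal_def, ← measureReal_def, div_lt_iff₀ hE0, hr] at hlt
  rw [show (a + b) / 2 - (b - a) / 2 = a by ring, show (a + b) / 2 + (b - a) / 2 = b by ring,
    show 2 * ((b - a) / 2) = b - a by ring]
  exact hlt

lemma continuous_measureReal_inter_Ioi {E : Set ℝ} (hE : MeasurableSet E) (h : volume E ≠ ⊤) :
    Continuous fun c => volume.real (E ∩ Ioi c) := by
  have hi : Integrable (E.indicator (1 : ℝ → ℝ)) := integrable_indicator_one hE h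
  have h1 : ∀ c, volume.real (E ∩ Ioi c) =
      (∫ x in Ioi (0 : ℝ), E.indicator (1 : ℝ → ℝ) x) -
        ∫ x in (0 : ℝ)..c, E.indicator (1 : ℝ → ℝ) x := by
    intro c
    have h2 := intervalIntegral.integral_interval_add_Ioi (a := 0) (b := c) hi.integrableOn
      hi.integrableOn
    rw [← h2, add_sub_cancel_left, integral_indicator_one hE, measureReal_restrict_apply hE]
  simp only [h1]
  exact continuous_const.sub (intervalIntegral.continuous_primitive
    (fun a b => hi.intervalIntegrable) 0)

lemma measureReal_inter_le_add {A E s : Set ℝ} (hA : volume A ≠ ⊤) (hE : volume E ≠ ⊤) :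
    volume.real (A ∩ s) ≤ volume.real (E ∩ s) + volume.real (A ∆ E) := by
  have hd : volume (A ∆ E) ≠ ⊤ :=
    ((measure_mono symmDiff_subset_union).trans_lt
      ((measure_union_le _ _).trans_lt (ENNReal.add_lt_top.2 ⟨hA.lt_top, hE.lt_top⟩))).ne
  have hEs : volume (E ∩ s) ≠ ⊤ := ((measure_mono inter_subset_left).trans_lt hE.lt_top).ne
  refine (measureReal_mono (s₂ := (E ∩ s) ∪ (A ∆ E)) ?_ ?_).trans (measureReal_union_le _ _)
  · rintro x ⟨hxA, hxs⟩
    by_cases hxE : x ∈ E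
    · exact Or.inl ⟨hxE, hxs⟩
    · exact Or.inr (Or.inl ⟨hxA, hxE⟩)
  · exact ((measure_union_le _ _).trans_lt
      (ENNReal.add_lt_top.2 ⟨hEs.lt_top, hd.lt_top⟩)).ne

/-- A set close to an interval has a median close to the centre of the interval. -/
lemma exists_median {E : Set ℝ} (hE : MeasurableSet E) (h : volume E ≠ ⊤) {c r : ℝ}
    (hε : volume.real (Icc (c - r) (c + r) ∆ E) ≤ r) :
    ∃ m, |m - c| ≤ volume.real (Icc (c - r) (c + r) ∆ E) ∧ volume.real (E ∩ Ioi m) = r := by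
  set I := Icc (c - r) (c + r) with hI
  set ε := volume.real (I ∆ E) with hεd
  have hε0 : 0 ≤ ε := measureReal_nonneg
  have hIf : volume I ≠ ⊤ := by simp [hI]
  have hIv : ∀ t, c - r ≤ t → t ≤ c + r → volume.real (I ∩ Ioi t) = c + r - t := by
    intro t h1 h2
    have e : I ∩ Ioi t = Ioc t (c + r) := by
      ext x
      simp only [hI, mem_inter_iff, mem_Icc, mem_Ioi, mem_Ioc]
      constructor <;> intro hx
      · exact ⟨hx.2, hx.1.2⟩
      · exact ⟨⟨by linarith [hx.1], hx.2⟩, hx.1⟩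
    rw [e, Real.volume_real_Ioc_of_le h2]
  -- The interval has mass r + ε to the right of c - ε and r - ε to the right of c + ε; passing to
  -- `E` changes either by at most ε, so the intermediate value theorem applies.
  have hlo : r ≤ volume.real (E ∩ Ioi (c - ε)) := by
    have h1 := measureReal_inter_le_add (s := Ioi (c - ε)) hIf h
    rw [hIv _ (by linarith) (by linarith)] at h1
    linarith
  have hhi : volume.real (E ∩ Ioi (c + ε)) ≤ r := by
    have h1 := measureReal_inter_le_add (s := Ioi (c + ε)) h hIf
    rw [hIv _ (by linarith) (by linarith), symmDiff_comm] at h1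
    linarith
  obtain ⟨m, hm, hmr⟩ := intermediate_value_Icc' (by linarith : c - ε ≤ c + ε)
    (continuous_measureReal_inter_Ioi hE h).continuousOn ⟨hhi, hlo⟩
  exact ⟨m, abs_le.2 ⟨by linarith [hm.1], by linarith [hm.2]⟩, hmr⟩

lemma measureReal_Icc_symmDiff_Icc_le (c d r : ℝ) :
    volume.real (Icc (c - r) (c + r) ∆ Icc (d - r) (d + r)) ≤ 2 * |c - d| := by
  have hsub : Icc (c - r) (c + r) ∆ Icc (d - r) (d + r) ⊆
      uIcc (d - r) (c - r) ∪ uIcc (d + r) (c + r) := by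
    intro x hx
    simp only [mem_union, mem_uIcc]
    rcases mem_symmDiff.1 hx with ⟨⟨h1, h2⟩, h3⟩ | ⟨⟨h1, h2⟩, h3⟩
    · rcases le_or_gt (d - r) x with h | h
      · exact Or.inr (Or.inl ⟨(not_le.1 fun h4 => h3 ⟨h, h4⟩).le, h2⟩)
      · exact Or.inl (Or.inr ⟨h1, h.le⟩)
    · rcases le_or_gt (c - r) x with h | h
      · exact Or.inr (Or.inr ⟨(not_le.1 fun h4 => h3 ⟨h, h4⟩).le, h2⟩)
      · exact Or.inl (Or.inl ⟨h1, h.le⟩)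
  have hf : volume (uIcc (d - r) (c - r) ∪ uIcc (d + r) (c + r)) ≠ ⊤ :=
    ((measure_union_le _ _).trans_lt (by simp [Real.volume_interval])).ne
  refine ((measureReal_mono hsub hf).trans (measureReal_union_le _ _)).trans (le_of_eq ?_)
  rw [measureReal_def, measureReal_def, Real.volume_interval, Real.volume_interval,
    ENNReal.toReal_ofReal (abs_nonneg _), ENNReal.toReal_ofReal (abs_nonneg _)]
  rw [sub_sub_sub_cancel_right, add_sub_add_right_eq_sub]
  ring

/-- Take an interval with ε = |I ∆ E| < 2rη. Recentring it at a median moves it by at most ε, which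
costs at most 2ε; the total 3ε, divided by r, is below 6η. The assumption η ≤ 1/2 ensures ε ≤ r, as
the median argument needs. -/
lemma exists_rescale {E : Set ℝ} (hE : MeasurableSet E) (h0 : 0 < volume E) (h : volume E ≠ ⊤)
    {η : ℝ} (hη1 : η ≤ 1 / 2) (hη : distEllipsoids E < η) :
    ∃ c r : ℝ, 0 < r ∧ volume (rescale c r E) = 2 ∧ volume (rescale c r E ∩ Ioi 0) = 1 ∧
      distEllipsoids E ≤ volume.real (unitBall ∆ rescale c r E) / 2 ∧
      volume.real (unitBall ∆ rescale c r E) ≤ 6 * η := by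
  obtain ⟨c, r, hr, hEr, hlt⟩ := exists_Icc_of_distEllipsoids_lt h0 h hη
  obtain ⟨m, hm, hmr⟩ := exists_median hE h (c := c) (r := r) (by nlinarith)
  have hv : ∀ S : Set ℝ, volume S ≠ ⊤ → volume S = ENNReal.ofReal (volume.real S) := fun S hS => by
    rw [measureReal_def, ENNReal.ofReal_toReal hS]
  refine ⟨m, r, hr, ?_, ?_, distEllipsoids_le h hr hEr, ?_⟩
  · rw [volume_rescale hr, hv E h, hEr, ← ENNReal.ofReal_mul (inv_pos.2 hr).le,
      show r⁻¹ * (2 * r) = 2 by field_simp, ENNReal.ofReal_ofNat]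
  · have e : rescale m r E ∩ Ioi 0 = rescale m r (E ∩ Ioi m) := by
      ext y
      simp only [mem_inter_iff, mem_rescale, mem_Ioi]
      refine and_congr_right fun _ => ⟨fun hy => by nlinarith, fun hy => ?_⟩
      have : 0 < r * y := by linarith
      exact pos_of_mul_pos_right this hr.le
    rw [e, volume_rescale hr, hv (E ∩ Ioi m) ((measure_mono inter_subset_left).trans_lt
      h.lt_top).ne, hmr, ← ENNReal.ofReal_mul (inv_pos.2 hr).le, inv_mul_cancel₀ hr.ne',
      ENNReal.ofReal_one]
  · rw [unitBall_symmDiff_rescale hr, volume_real_rescale hr, inv_mul_le_iff₀ hr]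
    have h1 := measureReal_symmDiff_le (μ := volume) (s := Icc (m - r) (m + r))
      (t := Icc (c - r) (c + r)) E (by simp) (by simp)
    have h2 := measureReal_Icc_symmDiff_Icc_le m c r
    linarith

/-! ### From the integral estimate to the norm, and conclusion. -/

lemma sub_rpow_inv_le {A t q : ℝ} (hA : 0 < A) (hq : 1 ≤ q) (htA : t ≤ A) :
    (A - t) ^ q⁻¹ ≤ A ^ q⁻¹ - A ^ q⁻¹ * (q * A)⁻¹ * t := by
  have hq0 : 0 < q := by linarith
  have h1 : A - t = A * (1 + -(t / A)) := by field_simp; ring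
  have h2 : t / A ≤ 1 := (div_le_one hA).2 htA
  have h3 := rpow_one_add_le_one_add_mul_self (s := -(t / A)) (by linarith) (p := q⁻¹)
    (by positivity) (inv_le_one_of_one_le₀ hq)
  rw [h1, mul_rpow hA.le (by linarith)]
  calc A ^ q⁻¹ * (1 + -(t / A)) ^ q⁻¹ ≤ A ^ q⁻¹ * (1 + q⁻¹ * -(t / A)) := by gcongr
    _ = _ := by field_simp; ring

lemma integral_norm_indicatorHat_unitBall_pos {q : ℝ} (hq : 1 < q) :
    0 < ∫ ξ, ‖indicatorHat unitBall ξ‖ ^ q := by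
  simp only [indicatorHat_unitBall, Complex.norm_real, norm_eq_abs]
  have hi : Integrable (fun ξ : ℝ => |2 * sinc (2 * π * ξ)| ^ q) := by
    simpa only [rpow_zero, mul_one] using
      integrable_ballHat_rpow_mul (r := q) (θ := 0) (by linarith) le_rfl (by linarith)
  refine integral_pos_of_integrable_nonneg_nonzero (x := 0) ?_ hi (fun ξ => by positivity) ?_
  · have := continuous_sinc
    exact Continuous.rpow_const (by fun_prop) fun _ => Or.inr (by linarith)
  · simp
    positivity

end FourierExtremizer

open FourierExtremizer in
theorem proposition2p8 (q : ℝ) (hq : 3 < q)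
    (hK : ∀ δ : ℝ, 0 < δ → δ ≤ 1 →
      sSup (FourierExtremizer.K q '' {x : ℝ | 1 + δ ≤ |x|}) <
        sInf (FourierExtremizer.K q '' {x : ℝ | |x| ≤ 1 - δ})) :
    ∃ c : ℝ, 0 < c ∧ ∃ η : ℝ, 0 < η ∧
      ∀ E : Set ℝ, NullMeasurableSet E volume → 0 < volume E → volume E < ⊤ →
        FourierExtremizer.distEllipsoids E < η →
          FourierExtremizer.Phi q E ≤ FourierExtremizer.Phi q FourierExtremizer.unitBall -
            c * FourierExtremizer.distEllipsoids E ^ 2 := by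
  obtain ⟨c, hc, δ₀, hδ₀, hmain⟩ := exists_integral_norm_indicatorHat_rpow_le hq
  have hA := integral_norm_indicatorHat_unitBall_pos (q := q) (by linarith)
  set A := ∫ ξ, ‖indicatorHat unitBall ξ‖ ^ q with hAd
  -- The factors are the normalisation |B|^{-1/q'}, the slope of z ↦ z^{1/q} at A, and 4 from
  -- `distEllipsoids E` ≤ δ/2. The threshold δ₀/6 matches the 6η of `exists_rescale`.
  refine ⟨2 ^ (-((q - 1) / q)) * (A ^ q⁻¹ * (q * A)⁻¹ * (c * 4)), by positivity,
    min (1 / 2) (δ₀ / 6), by positivity, fun E₀ hE₀ h0 hfin hη => ?_⟩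
  obtain ⟨E, -, hE, hEE₀⟩ := hE₀.exists_measurable_superset_ae_eq
  rw [← measure_congr hEE₀] at h0 hfin
  rw [← distEllipsoids_congr hEE₀] at hη ⊢
  rw [← Phi_congr hEE₀]
  obtain ⟨m, r, hr, hv, hv1, hdist, hle⟩ := exists_rescale hE h0 hfin.ne (min_le_left _ _) hη
  have hδ : volume.real (unitBall ∆ rescale m r E) ≤ δ₀ := by
    linarith [min_le_right (1 / 2) (δ₀ / 6)]
  have key := hmain _ (measurableSet_rescale hE) hv hv1 hδ
  set δ := volume.real (unitBall ∆ rescale m r E) with hδd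
  set X := ∫ ξ, ‖indicatorHat (rescale m r E) ξ‖ ^ q with hX
  have hX0 : 0 ≤ X := integral_nonneg fun ξ => by positivity
  have hd0 := distEllipsoids_nonneg E
  have hroot : X ^ q⁻¹ ≤ A ^ q⁻¹ - A ^ q⁻¹ * (q * A)⁻¹ * (c * δ ^ 2) :=
    (Real.rpow_le_rpow hX0 key (by positivity)).trans
      (sub_rpow_inv_le hA (by linarith) (by linarith))
  have hsq : 4 * distEllipsoids E ^ 2 ≤ δ ^ 2 := by nlinarith
  rw [← Phi_rescale (by linarith) hr hE hfin.ne (c := m),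
    Phi_eq (by linarith) (measurableSet_rescale hE) (by simp [hv]),
    Phi_eq (by linarith) measurableSet_unitBall (by simp [volume_unitBall]), measureReal_def,
    measureReal_def, hv, volume_unitBall, ENNReal.toReal_ofNat, ← hAd, ← hX]
  have hP : 0 < A ^ q⁻¹ * (q * A)⁻¹ * c := by positivity
  calc (2 : ℝ) ^ (-((q - 1) / q)) * X ^ q⁻¹ ≤
      2 ^ (-((q - 1) / q)) * (A ^ q⁻¹ - A ^ q⁻¹ * (q * A)⁻¹ * c * (4 * distEllipsoids E ^ 2)) := by
        gcongr
        refine hroot.trans ?_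
        rw [← mul_assoc]
        gcongr
    _ = _ := by ring
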